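/- Let $\Delta_{0,1}\subset\mathbb C$ be an equilateral triangle of circumference $2\pi$ with one vertex pointing upwards, and let $SG$ be the Sierpinski gasket obtained by repeatedly cutting the solid triangle bounded by $\Delta_{0,1}$. For $n\ge 0$ let $\Delta_{n,j}$, $1\le j\le 3^n$, be the $3^n$ upward pointing triangles of circumference $2\pi 2^{-n}$ in $SG$ which are the images of $\Delta_{0,1}$ under the compositions of $n$ of the three contractions by $1/2$ towards its vertices, and for $m\ge 1$ let $\nabla_{m,k}$, $1\le k\le 3^{m-1}$, be the downward pointing triangles of circumference $2\pi 2^{-m}$ which bound the bounded components (holes) of $\mathbb C\setminus SG$. Let $HSG=\{(m,k): m\ge 1,\ 1\le k\le 3^{m-1}\}$. All these triangles are parametrized counterclockwise by arc length, and $\nabla_{m,k}\subset\Delta_{n,j}$ means that $\nabla_{m,k}$ lies in $\Delta_{n,j}$ taken together with its interior. For a triangle $\Gamma$ of circumference $2\pi r$ from this list let $UFM(\Gamma)$ be the unbounded Fredholm module $(H_\Gamma,\pi_\Gamma,D_\Gamma)$ over $C(SG)$, where $H_\Gamma$ is the $L^2$-space of the circle of length $2\pi r$ with normalized arc length, $\pi_\Gamma(f)$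 is multiplication by the pull-back of $f$ along the parametrization of $\Gamma$, and $D_\Gamma=\frac1i\frac{d}{dx}+\frac1{2r}$ with its natural domain, so that $D_\Gamma e^{ikx/r}=\frac{k+1/2}{r}e^{ikx/r}$ for $k\in\mathbb Z$. Let $P_\Gamma$ be the spectral projection of $D_\Gamma$ for $[0,\infty)$. The index map of $UFM(\Gamma)$ is the homomorphism $\Phi_{UFM(\Gamma)}:K_1(C(SG))\to\mathbb Z$ which maps the class of a unitary matrix $u\in U_l(C(SG))$ to $-\mathrm{Index}$ of the compression of $(\pi_\Gamma(u_{ij}))_{i,j}$ to $(P_\Gamma H_\Gamma)^l$, where $K_1(C(SG))$ is the quotient of $U_\infty(C(SG))=\bigcup_l U_l(C(SG))$ by the subgroup of elements that can be joined to $1$ by a path. For a continuous $f: SG\to\mathbb C\setminus\{0\}$ let $w_\Gamma(f)$ be the winding number around $0$ of the restriction of $f$ to $\Gamma$. **Proposition.** The compressions are Fredholm operators and the index maps are well defined homomorphisms on $K_1(C(SG))$. For every unitary $u$ in $C(SG)$ and all $n,j$, respectively all $(m,k)\in HSG$: (i) $\Phi_{UFM(\Delta_{n,j})}([u])=w_{\Delta_{n,j}}(u)$.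 (ii) $\Phi_{UFM(\nabla_{m,k})}([u])=w_{\nabla_{m,k}}(u)$. (iii) $\Phi_{UFM(\Delta_{n,j})}([u])=\sum_{\nabla_{m,k}\subset\Delta_{n,j}}w_{\nabla_{m,k}}(u)$, where only finitely many terms of the sum are non-zero. (iv) The element $\Phi_{UFM(\Delta_{n,j})}$ of $\mathrm{Hom}(K_1(C(SG)),\mathbb Z)=\prod_{(m,k)\in HSG}\mathbb Z$ is the function $f_{\Delta_{n,j}}:HSG\to\mathbb Z$ with $f_{\Delta_{n,j}}(m,k)=1$ if $\nabla_{m,k}\subset\Delta_{n,j}$ and $0$ otherwise. That is: with $c_{m,k}$ the center of the hole bounded by $\nabla_{m,k}$, the value of $\Phi_{UFM(\Delta_{n,j})}$ on the generator $[(z-c_{m,k})/|z-c_{m,k}|]$ is $f_{\Delta_{n,j}}(m,k)$ for all $(m,k)\in HSG$; and for every $l$ and every unitary matrix $u\in U_l(C(SG))$ only finitely many of the integers $w_{\nabla_{m,k}}(\det u)$ are non-zero and $$\Phi_{UFM(\Delta_{n,j})}([u])=\sum_{(m,k)\in HSG}f_{\Delta_{n,j}}(m,k)\,w_{\nabla_{m,k}}(\det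 u).$$ -/

import Mathlib

namespace Gasket

noncomputable section

section KTheory

variable {A : Type*} [CommRing A]

/-- The identification of `{0, …, n-1}` with the disjoint union of `{0, …, m-1}` and
`{0, …, n-m-1}`. -/
def blockEquiv {m n : ℕ} (h : m ≤ n) : Fin n ≃ Fin m ⊕ Fin (n - m) :=
  (finCongr (Nat.add_sub_cancel' h).symm).trans finSumFinEquiv.symm

/-- The block diagonal matrix `u ⊕ 1` of size `n`, for a matrix `u` of size `m ≤ n`. -/
def pad {m n : ℕ} (h : m ≤ n) (u : Matrix (Fin m) (Fin m) A) : Matrix (Fin n) (Fin n) A :=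
  (Matrix.fromBlocks u 0 0 1).submatrix (blockEquiv h) (blockEquiv h)

theorem blockEquiv_of_lt {m n : ℕ} (h : m ≤ n) (i : Fin n) (hi : i.1 < m) :
    blockEquiv h i = Sum.inl ⟨i.1, hi⟩ := by
  rw [blockEquiv, Equiv.trans_apply, Equiv.symm_apply_eq]
  ext; simp

theorem blockEquiv_of_le {m n : ℕ} (h : m ≤ n) (i : Fin n) (hi : m ≤ i.1) :
    blockEquiv h i = Sum.inr ⟨i.1 - m, by omega⟩ := by
  rw [blockEquiv, Equiv.trans_apply, Equiv.symm_apply_eq]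
  ext; simp; omega

theorem pad_apply {m n : ℕ} (h : m ≤ n) (u : Matrix (Fin m) (Fin m) A) (i j : Fin n) :
    pad h u i j = if hi : i.1 < m then (if hj : j.1 < m then u ⟨i.1, hi⟩ ⟨j.1, hj⟩ else 0)
      else (if i = j then 1 else 0) := by
  by_cases hi : i.1 < m <;> by_cases hj : j.1 < m
  · simp [pad, blockEquiv_of_lt h i hi, blockEquiv_of_lt h j hj, hi, hj]
  · simp [pad, blockEquiv_of_lt h i hi, blockEquiv_of_le h j (not_lt.1 hj), hi, hj]
  · have : i ≠ j := by rintro rfl; exact hi hj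
    simp [pad, blockEquiv_of_le h i (not_lt.1 hi), blockEquiv_of_lt h j hj, hi, this]
  · simp only [pad, Matrix.submatrix_apply, blockEquiv_of_le h i (not_lt.1 hi),
      blockEquiv_of_le h j (not_lt.1 hj), Matrix.fromBlocks_apply₂₂, Matrix.one_apply, hi,
      dite_false, Fin.ext_iff]
    congr 1
    simp only [eq_iff_iff]; omega

theorem pad_mul {m n : ℕ} (h : m ≤ n) (u v : Matrix (Fin m) (Fin m) A) :
    pad h (u * v) = pad h u * pad h v := by
  simp [pad, Matrix.submatrix_mul_equiv, Matrix.fromBlocks_multiply]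

theorem pad_one {m n : ℕ} (h : m ≤ n) : pad h (1 : Matrix (Fin m) (Fin m) A) = 1 := by
  simp [pad]

variable [StarRing A]

theorem pad_star {m n : ℕ} (h : m ≤ n) (u : Matrix (Fin m) (Fin m) A) :
    pad h (star u) = star (pad h u) := by
  simp [pad, Matrix.star_eq_conjTranspose, Matrix.fromBlocks_conjTranspose]

/-- The embedding `u ↦ u ⊕ 1` of the unitary group `U_m(A)` into `U_n(A)` for `m ≤ n`. -/
def padHom (A : Type*) [CommRing A] [StarRing A] (m n : ℕ) (h : m ≤ n) :
    Matrix.unitaryGroup (Fin m) A →* Matrix.unitaryGroup (Fin n) A where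
  toFun u := ⟨pad h u.1, by
    rw [Matrix.mem_unitaryGroup_iff, ← pad_star, ← pad_mul,
      Matrix.mem_unitaryGroup_iff.1 u.2, pad_one]⟩
  map_one' := Subtype.ext (pad_one h)
  map_mul' u v := Subtype.ext (pad_mul h u.1 v.1)

instance padHom_directedSystem : DirectedSystem (fun n => Matrix.unitaryGroup (Fin n) A)
    (fun m n h => padHom A m n h) where
  map_self n u := by
    apply Subtype.ext; ext i j
    simp [padHom, pad_apply]
  map_map k m n hkm hmn u := by
    apply Subtype.ext; ext i j
    simp only [padHom, MonoidHom.coe_mk, OneHom.coe_mk, pad_apply, Fin.ext_iff]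
    split_ifs <;> first | rfl | omega

/-- The stable unitary group `U_∞(A)`, the union of the groups `U_n(A)` along `u ↦ u ⊕ 1`. -/
abbrev StableUnitary (A : Type*) [CommRing A] [StarRing A] : Type _ :=
  DirectLimit (fun n => Matrix.unitaryGroup (Fin n) A) (fun m n h => padHom A m n h)

/-- A unitary of `A`, as a `1 × 1` unitary matrix over `A`. -/
def oneByOne (u : unitary A) : Matrix.unitaryGroup (Fin 1) A :=
  ⟨Matrix.diagonal fun _ => (u : A), by
    rw [Matrix.mem_unitaryGroup_iff, Matrix.star_eq_conjTranspose, Matrix.diagonal_conjTranspose,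
      Matrix.diagonal_mul_diagonal, ← Matrix.diagonal_one]
    congr 1; ext i
    simp⟩

variable [TopologicalSpace A]

theorem continuous_padHom (m n : ℕ) (h : m ≤ n) : Continuous (padHom A m n h) := by
  refine Continuous.subtype_mk ?_ _
  exact (continuous_subtype_val.matrix_fromBlocks continuous_const continuous_const
    continuous_const).matrix_submatrix _ _

variable [IsTopologicalRing A]

theorem joined_mul {M : Type*} [Monoid M] [TopologicalSpace M] [ContinuousMul M] {a b c d : M}
    (h : Joined a b) (h' : Joined c d) : Joined (a * c) (b * d) :=
  ⟨h.somePath.mul h'.somePath⟩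

/-- The normal subgroup of those elements of `U_∞(A)` which have a representative in some `U_n(A)`
that is connected to the identity by a continuous path in `U_n(A)`. -/
def nullHomotopic (A : Type*) [CommRing A] [StarRing A] [TopologicalSpace A]
    [IsTopologicalRing A] : Subgroup (StableUnitary A) where
  carrier := {x | ∃ (n : ℕ) (u : Matrix.unitaryGroup (Fin n) A), x = ⟦⟨n, u⟩⟧ ∧ Joined 1 u}
  one_mem' := ⟨0, 1, DirectLimit.one_def 0, Joined.refl _⟩
  mul_mem' := by
    rintro _ _ ⟨m, u, rfl, hu⟩ ⟨n, v, rfl, hv⟩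
    refine ⟨max m n, padHom A m _ (le_max_left m n) u * padHom A n _ (le_max_right m n) v, ?_, ?_⟩
    · rw [← DirectLimit.mul_def, DirectLimit.mk_apply, DirectLimit.mk_apply]
    · have h1 := hu.map (continuous_padHom m _ (le_max_left m n))
      have h2 := hv.map (continuous_padHom n _ (le_max_right m n))
      rw [map_one] at h1 h2
      simpa using joined_mul h1 h2
  inv_mem' := by
    rintro _ ⟨m, u, rfl, hu⟩
    refine ⟨m, u⁻¹, by rw [DirectLimit.inv_def], ?_⟩
    simpa using joined_mul hu.symm (Joined.refl u⁻¹)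

instance nullHomotopic_normal : (nullHomotopic A).Normal where
  conj_mem := by
    rintro _ ⟨m, u, rfl, hu⟩ y
    obtain ⟨n, v, rfl⟩ := DirectLimit.exists_eq_mk (f := fun m n h => padHom A m n h) y
    refine ⟨max m n, padHom A n _ (le_max_right m n) v * padHom A m _ (le_max_left m n) u *
      (padHom A n _ (le_max_right m n) v)⁻¹, ?_, ?_⟩
    · rw [← DirectLimit.mul_def, ← DirectLimit.mul_def, ← DirectLimit.inv_def,
        DirectLimit.mk_apply, DirectLimit.mk_apply]
    · have h1 := hu.map (continuous_padHom m _ (le_max_left m n))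
      rw [map_one] at h1
      have := joined_mul (joined_mul (Joined.refl (padHom A n _ (le_max_right m n) v)) h1)
        (Joined.refl (padHom A n _ (le_max_right m n) v)⁻¹)
      simpa using this

/-- The topological K-group `K₁(A) = U_∞(A) / U_∞(A)₀`, written additively. -/
abbrev K1 (A : Type*) [CommRing A] [StarRing A] [TopologicalSpace A] [IsTopologicalRing A] :
    Type _ :=
  Additive (StableUnitary A ⧸ nullHomotopic A)

/-- The class in `K₁(A)` of a unitary matrix over `A`. -/
def K1.mk {n : ℕ} (u : Matrix.unitaryGroup (Fin n) A) : K1 A :=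
  Additive.ofMul (QuotientGroup.mk (s := nullHomotopic A) ⟦⟨n, u⟩⟧)

/-- The class `[u]` in `K₁(A)` of a unitary `u` of `A`. -/
def K1.ofUnitary (u : unitary A) : K1 A := K1.mk (oneByOne u)

end KTheory

section Modules

/-- The data of an (odd) unbounded module over `C(X)`: a Hilbert space, a representation of `C(X)`
on it by bounded operators, and an unbounded operator, the Dirac operator. -/
structure UnboundedModule (X : Type) [TopologicalSpace X] where
  /-- the Hilbert space -/
  H : Type
  [normed : NormedAddCommGroup H]
  [inner : InnerProductSpace ℂ H]
  [complete : CompleteSpace H]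
  /-- the representation of `C(X)` -/
  rep : C(X, ℂ) →⋆ₐ[ℂ] (H →L[ℂ] H)
  /-- the Dirac operator -/
  dirac : H →ₗ.[ℂ] H

attribute [instance] UnboundedModule.normed UnboundedModule.inner UnboundedModule.complete

variable {X : Type} [TopologicalSpace X]

/-- The range of the spectral projection `E([0, ∞[)` of the Dirac operator. An operator with compact
resolvent has an orthonormal basis of eigenvectors, so this is the closed linear span of the
eigenvectors with nonnegative eigenvalue. -/
def UnboundedModule.posSpace (M : UnboundedModule X) : Submodule ℂ M.H :=
  (Submodule.span ℂ {x : M.H | ∃ μ : ℝ, 0 ≤ μ ∧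
    ∃ hx : x ∈ M.dirac.domain, M.dirac ⟨x, hx⟩ = (μ : ℂ) • x}).topologicalClosure

instance (M : UnboundedModule X) : CompleteSpace M.posSpace :=
  inferInstanceAs (CompleteSpace (Submodule.topologicalClosure _))

/-- The compression `P π(f) P` of `π(f)` to the range of `P = E([0, ∞[)`. -/
def UnboundedModule.compression (M : UnboundedModule X) (f : C(X, ℂ)) :
    M.posSpace →L[ℂ] M.posSpace :=
  M.posSpace.orthogonalProjectionOnto ∘L M.rep f ∘L M.posSpace.subtypeL

/-- The compression to `(P H)^n` of the operator on `H^n` given by an `n × n` matrix of functions: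
its matrix of operators has the entries `P π(u i j) P`. -/
def UnboundedModule.matrixCompression (M : UnboundedModule X) {n : ℕ}
    (u : Matrix (Fin n) (Fin n) C(X, ℂ)) :
    (Fin n → M.posSpace) →L[ℂ] (Fin n → M.posSpace) :=
  ContinuousLinearMap.pi fun i => ∑ j, M.compression (u i j) ∘L ContinuousLinearMap.proj j

/-- The index `dim ker T - dim coker T` of a Fredholm operator. -/
def fredholmIndex {E F : Type*} [NormedAddCommGroup E] [NormedSpace ℂ E] [NormedAddCommGroup F]
    [NormedSpace ℂ F] (T : E →L[ℂ] F) : ℤ :=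
  (Module.finrank ℂ T.ker : ℤ) - (Module.finrank ℂ (F ⧸ T.range) : ℤ)

/-- `Φ` is the index map `K₁(C(X)) → ℤ` of the module `M`: for all unitary matrices `u` over `C(X)`
the compression of `u` is a Fredholm operator, and `Φ [u]` is the negative of its index. Every class
in `K₁` has such a representative, so at most one `Φ` satisfies this. -/
def IsIndexMap [LocallyCompactSpace X] (M : UnboundedModule X) (Φ : K1 C(X, ℂ) →+ ℤ) : Prop :=
  ∀ (n : ℕ) (u : Matrix.unitaryGroup (Fin n) C(X, ℂ)),
    (M.matrixCompression u.1).IsFredholm ∧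
      Φ (K1.mk u) = -fredholmIndex (M.matrixCompression u.1)

end Modules

section Circle

variable (T : ℝ) [hT : Fact (0 < T)]

open AddCircle MeasureTheory

/-- The Hilbert space `L²` of the circle of circumference `T`, for the normalized arc length. -/
abbrev CircleL2 : Type := Lp ℂ 2 (@haarAddCircle T hT)

theorem star_clm_iff {H : Type*} [NormedAddCommGroup H] [InnerProductSpace ℂ H] [CompleteSpace H]
    (A B : H →L[ℂ] H) : A = star B ↔ ∀ x y, inner ℂ (A x) y = inner ℂ x (B y) := by
  rw [ContinuousLinearMap.star_eq_adjoint, ContinuousLinearMap.eq_adjoint_iff]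

/-- Multiplication by a continuous function on `L²` of the circle, as a bounded operator. -/
def mulCLM (f : C(AddCircle T, ℂ)) : CircleL2 T →L[ℂ] CircleL2 T :=
  (ContinuousLinearMap.mul ℂ ℂ).holderL (@haarAddCircle T hT) ⊤ 2 2
    (ContinuousMap.toLp ⊤ (@haarAddCircle T hT) ℂ f)

theorem coeFn_mulCLM (f : C(AddCircle T, ℂ)) (g : CircleL2 T) :
    mulCLM T f g =ᵐ[@haarAddCircle T hT] fun x => f x * g x := by
  have h1 := (ContinuousLinearMap.mul ℂ ℂ).coeFn_holder (r := 2)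
    (ContinuousMap.toLp ⊤ (@haarAddCircle T hT) ℂ f) g
  have h2 := ContinuousMap.coeFn_toLp (p := ⊤) (𝕜 := ℂ) (@haarAddCircle T hT) f
  filter_upwards [h1, h2] with x hx hx2
  rw [mulCLM, ContinuousLinearMap.holderL_apply_apply, hx, hx2]
  rfl

/-- The representation of `C(ℝ/Tℤ)` on `L²` of the circle by multiplication operators. -/
def mulOp : C(AddCircle T, ℂ) →⋆ₐ[ℂ] (CircleL2 T →L[ℂ] CircleL2 T) where
  toFun := mulCLM T
  map_one' := by
    ext1 g
    apply Lp.ext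
    filter_upwards [coeFn_mulCLM T 1 g] with x hx
    simp [hx]
  map_mul' f g := by
    ext1 h
    apply Lp.ext
    filter_upwards [coeFn_mulCLM T (f * g) h, coeFn_mulCLM T f (mulCLM T g h),
      coeFn_mulCLM T g h] with x h1 h2 h3
    rw [h1, mul_apply_eq_comp, h2, h3, ContinuousMap.mul_apply, mul_assoc]
  map_zero' := by simp [mulCLM]
  map_add' f g := by simp [mulCLM]
  commutes' c := by
    ext1 g
    apply Lp.ext
    filter_upwards [coeFn_mulCLM T (algebraMap ℂ _ c) g, Lp.coeFn_smul c g] with x h1 h2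
    rw [h1, Algebra.algebraMap_eq_smul_one, Algebra.algebraMap_eq_smul_one]
    simpa using h2.symm
  map_star' f := by
    rw [star_clm_iff]
    intro g h
    rw [L2.inner_def, L2.inner_def]
    apply integral_congr_ae
    filter_upwards [coeFn_mulCLM T (star f) g, coeFn_mulCLM T f h] with x h1 h2
    rw [h1, h2]
    simp
    ring

/-- The eigenvalue `(k + 1/2) / r` of the Dirac operator on the circle of radius `r = T / 2π`. -/
def circleEigenvalue (k : ℤ) : ℝ := (k + 1 / 2) / (T / (2 * Real.pi))

/-- The domain of the Dirac operator of the circle: the `f` in `L²` with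
`∑ₖ |(k + 1/2) / r|² |f̂(k)|² < ∞`. -/
def circleDomain : Submodule ℂ (CircleL2 T) where
  carrier := {f | Memℓp (fun k : ℤ => (circleEigenvalue T k : ℂ) *
    (fourierBasis (T := T)).repr f k) 2}
  add_mem' := by
    intro f g hf hg
    have h := Memℓp.add hf hg
    have e : (fun k : ℤ => (circleEigenvalue T k : ℂ) * (fourierBasis (T := T)).repr (f + g) k) =
        (fun k : ℤ => (circleEigenvalue T k : ℂ) * (fourierBasis (T := T)).repr f k) +
          fun k : ℤ => (circleEigenvalue T k : ℂ) * (fourierBasis (T := T)).repr g k := by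
      ext k
      simp only [map_add, lp.coeFn_add, Pi.add_apply, mul_add]
    change Memℓp _ 2
    rw [e]
    exact h
  zero_mem' := by
    simpa using! (zero_memℓp (E := fun _ : ℤ => ℂ) (p := 2))
  smul_mem' := by
    intro c f hf
    have h := Memℓp.const_smul hf c
    have e : (fun k : ℤ => (circleEigenvalue T k : ℂ) * (fourierBasis (T := T)).repr (c • f) k) =
        c • fun k : ℤ => (circleEigenvalue T k : ℂ) * (fourierBasis (T := T)).repr f k := by
      ext k
      simp only [map_smul, lp.coeFn_smul, Pi.smul_apply, smul_eq_mul]; ring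
    change Memℓp _ 2
    rw [e]
    exact h

/-- The Dirac operator of the circle of radius `r = T / 2π`: the self-adjoint operator
`(1/i) d/dx + 1/(2r)`, which has the orthonormal basis `e_k(x) = exp (i k x / r)`, `k ∈ ℤ`, of
eigenvectors, with the eigenvalues `(k + 1/2) / r`. -/
def circleDirac : CircleL2 T →ₗ.[ℂ] CircleL2 T where
  domain := circleDomain T
  toFun := (fourierBasis (T := T)).repr.symm.toLinearEquiv.toLinearMap ∘ₗ
    { toFun f := (⟨_, f.2⟩ : lp (fun _ : ℤ => ℂ) 2)
      map_add' := by
        intro f g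
        apply lp.ext; ext k
        simp only [Submodule.coe_add, map_add, lp.coeFn_add, Pi.add_apply, mul_add]
      map_smul' := by
        intro c f
        apply lp.ext; ext k
        simp only [Submodule.coe_smul, map_smul, lp.coeFn_smul, Pi.smul_apply, smul_eq_mul,
          RingHom.id_apply]
        ring }

variable {T}
/-- The unbounded module over `C(X)` of a closed curve `γ` in `X`. -/
def loopModule {X : Type} [TopologicalSpace X] (γ : C(AddCircle T, X)) : UnboundedModule X where
  H := CircleL2 T
  rep := (mulOp T).comp (ContinuousMap.compStarAlgHom' ℂ ℂ γ)
  dirac := circleDirac T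

end Circle

section Winding

variable {T : ℝ}

/-- The closed curve `g` in `ℂ \ {0}` winds `k` times around `0` in the counterclockwise direction:
a continuous logarithm of `g` along `[0, T]` changes by `2πik`. -/
def HasWindingNumber (g : C(AddCircle T, ℂ)) (k : ℤ) : Prop :=
  ∃ L : C(ℝ, ℂ), (∀ t : ℝ, Complex.exp (L t) = g (t : AddCircle T)) ∧
    L T - L 0 = 2 * Real.pi * Complex.I * k

open Classical in
/-- The winding number around `0` of a closed curve `g` in `ℂ \ {0}` (and `0` by convention if `g`
takes the value `0`). -/
def windingNumber (g : C(AddCircle T, ℂ)) : ℤ :=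
  if h : ∃ k, HasWindingNumber g k then h.choose else 0

theorem exists_hasWindingNumber (g : C(AddCircle T, ℂ)) (hg : ∀ x, g x ≠ 0) :
    ∃ k, HasWindingNumber g k := by
  have cov := Complex.isCoveringMapOn_exp
  obtain ⟨L, ⟨-, hL⟩, -⟩ := cov.existsUnique_continuousMap_lifts
    (g.comp ⟨fun t : ℝ => (t : AddCircle T), AddCircle.continuous_mk' T⟩) (a₀ := (0 : ℝ))
    (e₀ := Complex.log (g ((0 : ℝ) : AddCircle T))) (by simpa using! Complex.exp_log (hg _))
    (fun t => hg _)
  have hL' : ∀ t : ℝ, Complex.exp (L t) = g (t : AddCircle T) := fun t => congrFun hL t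
  have h : Complex.exp (L T) = Complex.exp (L 0) := by
    rw [hL', hL', AddCircle.coe_period, QuotientAddGroup.mk_zero]
  obtain ⟨k, hk⟩ := Complex.exp_eq_exp_iff_exists_int.1 h
  exact ⟨k, L, hL', by rw [hk]; ring⟩

theorem HasWindingNumber.unique {g : C(AddCircle T, ℂ)} {k l : ℤ} (hk : HasWindingNumber g k)
    (hl : HasWindingNumber g l) : k = l := by
  obtain ⟨L, hL, hLk⟩ := hk
  obtain ⟨M, hM, hMl⟩ := hl
  have h : Complex.exp (L 0) = Complex.exp (M 0) := by rw [hL, hM]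
  obtain ⟨n, hn⟩ := Complex.exp_eq_exp_iff_exists_int.1 h
  have hg : ∀ x : ℝ, g (x : AddCircle T) ≠ 0 := fun x => by
    rw [← hL]; exact Complex.exp_ne_zero _
  obtain ⟨F, -, hF⟩ := Complex.isCoveringMapOn_exp.existsUnique_continuousMap_lifts
    (g.comp ⟨fun t : ℝ => (t : AddCircle T), AddCircle.continuous_mk' T⟩) (a₀ := (0 : ℝ))
    (e₀ := L 0) (hL 0) (fun t => hg _)
  have h1 := hF L ⟨rfl, funext hL⟩
  have h2 := hF (M + ContinuousMap.const ℝ (n * (2 * Real.pi * Complex.I))) ⟨by simp [hn], by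
    funext t
    simpa [Complex.exp_add, Complex.exp_int_mul_two_pi_mul_I] using! hM t⟩
  have h3 : L T - L 0 = M T - M 0 := by
    rw [h1.trans h2.symm]; simp
  rw [hLk, hMl] at h3
  have : (2 * Real.pi * Complex.I : ℂ) ≠ 0 := Complex.two_pi_I_ne_zero
  exact_mod_cast mul_left_cancel₀ this h3

theorem HasWindingNumber.windingNumber_eq {g : C(AddCircle T, ℂ)} {k : ℤ}
    (hk : HasWindingNumber g k) : windingNumber g = k := by
  have h : ∃ k, HasWindingNumber g k := ⟨k, hk⟩
  rw [windingNumber, dif_pos h]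
  exact h.choose_spec.unique hk

end Winding

section Geometry

/-- The vertices of the equilateral triangle of circumference `2π`, one vertex pointing upwards:
lower left, lower right, top. -/
def corner : Fin 3 → ℂ :=
  ![0, ⟨2 * Real.pi / 3, 0⟩, ⟨Real.pi / 3, Real.pi * √3 / 3⟩]

/-- The contraction by the factor `1/2` towards the vertex `corner i`. -/
def shrink (i : Fin 3) (z : ℂ) : ℂ := (z + corner i) / 2

/-- The steps of the cutting procedure: the solid triangle is replaced by three solid triangles of
half the size, and so on. -/
def stage : ℕ → Set ℂ
  | 0 => convexHull ℝ (Set.range corner)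
  | n + 1 => ⋃ i, shrink i '' stage n

/-- The Sierpinski gasket. -/
def gasket : Set ℂ := ⋂ n, stage n

/-- The index set of the holes of the gasket: a word `w` of length `m - 1` in the three letters
`0, 1, 2` stands for the pair `(m, k)`, `1 ≤ k ≤ 3 ^ (m - 1)`. The same words, of length `n`, number
the `3 ^ n` upward triangles of level `n`. -/
abbrev HSG : Type := List (Fin 3)

/-- The similarity of factor `2 ^ (-n)` which belongs to a word of length `n`. -/
def cellMap : HSG → ℂ → ℂ
  | [] => id
  | i :: w => shrink i ∘ cellMap w

theorem corner_mem_stage_zero (i : Fin 3) : corner i ∈ stage 0 :=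
  subset_convexHull ℝ _ ⟨i, rfl⟩

theorem continuous_shrink (i : Fin 3) : Continuous (shrink i) := by
  unfold shrink; fun_prop

theorem continuous_cellMap (w : HSG) : Continuous (cellMap w) := by
  induction w with
  | nil => exact continuous_id
  | cons i w ih => exact (continuous_shrink i).comp ih

theorem isCompact_stage (n : ℕ) : IsCompact (stage n) := by
  induction n with
  | zero => exact (Set.finite_range corner).isCompact_convexHull ℝ
  | succ n ih => exact isCompact_iUnion fun i => ih.image (continuous_shrink i)

theorem isCompact_gasket : IsCompact gasket :=
  (isCompact_stage 0).of_isClosed_subset (isClosed_iInter fun n => (isCompact_stage n).isClosed)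
    (Set.iInter_subset _ 0)

instance compactSpace_gasket : CompactSpace gasket := isCompact_iff_compactSpace.1 isCompact_gasket

theorem shrink_mem_gasket (i : Fin 3) {z : ℂ} (hz : z ∈ gasket) : shrink i z ∈ gasket := by
  rw [gasket, Set.mem_iInter] at hz ⊢
  rintro (_ | n)
  · have hconv : Convex ℝ (stage 0) := convex_convexHull ℝ (Set.range corner)
    have h : (1 / 2 : ℝ) • z + (1 / 2 : ℝ) • corner i ∈ stage 0 :=
      hconv (hz 0) (corner_mem_stage_zero i) (by norm_num) (by norm_num) (by norm_num)
    convert! h using 1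
    simp [shrink]; ring
  · exact Set.mem_iUnion.2 ⟨i, z, hz n, rfl⟩

theorem cellMap_mem_gasket (w : HSG) {z : ℂ} (hz : z ∈ gasket) : cellMap w z ∈ gasket := by
  induction w with
  | nil => exact hz
  | cons i w ih => exact shrink_mem_gasket i ih

theorem segment_corner_subset (i j : Fin 3) : segment ℝ (corner i) (corner j) ⊆ gasket := by
  rw [gasket, Set.subset_iInter_iff]
  intro n
  induction n generalizing i j with
  | zero =>
    exact (convex_convexHull ℝ (Set.range corner)).segment_subset (corner_mem_stage_zero i)
      (corner_mem_stage_zero j)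
  | succ n ih =>
    rintro z ⟨a, b, ha, hb, hab, rfl⟩
    have hab' : (a : ℂ) + b = 1 := by exact_mod_cast hab
    rcases le_total b (1 / 2) with h | h
    · refine Set.mem_iUnion.2 ⟨i, _, ih i j ⟨1 - 2 * b, 2 * b, by linarith, by linarith, by ring,
        rfl⟩, ?_⟩
      simp [shrink]
      linear_combination -corner i * hab'
    · refine Set.mem_iUnion.2 ⟨j, _, ih i j ⟨2 * a, 1 - 2 * a, by linarith, by linarith, by ring,
        rfl⟩, ?_⟩
      simp [shrink]
      linear_combination -corner j * hab'

/-- The midpoint of the side between two vertices. -/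
def midpt (i j : Fin 3) : ℂ := (corner i + corner j) / 2

theorem segment_midpt_subset (i j k : Fin 3) : segment ℝ (midpt i j) (midpt j k) ⊆ gasket := by
  rintro z ⟨a, b, ha, hb, hab, rfl⟩
  have hab' : (a : ℂ) + b = 1 := by exact_mod_cast hab
  have h := shrink_mem_gasket j (segment_corner_subset i k ⟨a, b, ha, hb, hab, rfl⟩)
  convert! h using 1
  simp [shrink, midpt]
  linear_combination (1 / 2) * corner j * hab'

/-- The parametrization on `[0, 1]` of the boundary of the triangle `a, b, c`, in the direction
`a → b → c → a`, with constant speed on each side and a third of the time for each side. -/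
def trianglePath (a b c : ℂ) (s : ℝ) : ℂ :=
  a + (max 0 (min (3 * s) 1)) • (b - a) + (max 0 (min (3 * s - 1) 1)) • (c - b) +
    (max 0 (min (3 * s - 2) 1)) • (a - c)

theorem trianglePath_mem (a b c : ℂ) (s : ℝ) :
    trianglePath a b c s ∈ segment ℝ a b ∪ segment ℝ b c ∪ segment ℝ c a := by
  have key : ∀ (x : ℝ) (p q : ℂ), p + (max 0 (min x 1)) • (q - p) ∈ segment ℝ p q := by
    intro x p q
    rw [segment_eq_image']
    exact ⟨_, ⟨le_max_left _ _, max_le zero_le_one (min_le_right _ _)⟩, rfl⟩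
  rcases le_total (3 * s) 1 with h1 | h1
  · refine Or.inl (Or.inl ?_)
    have e2 : max 0 (min (3 * s - 1) 1) = 0 := max_eq_left ((min_le_left _ _).trans (by linarith))
    have e3 : max 0 (min (3 * s - 2) 1) = 0 := max_eq_left ((min_le_left _ _).trans (by linarith))
    simpa [trianglePath, e2, e3] using key (3 * s) a b
  · have e1 : max 0 (min (3 * s) 1) = 1 := by rw [min_eq_right h1]; simp
    rcases le_total (3 * s) 2 with h2 | h2
    · refine Or.inl (Or.inr ?_)
      have e3 : max 0 (min (3 * s - 2) 1) = 0 := max_eq_left ((min_le_left _ _).trans (by linarith))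
      simpa [trianglePath, e1, e3] using key (3 * s - 1) b c
    · refine Or.inr ?_
      have e2 : max 0 (min (3 * s - 1) 1) = 1 := by rw [min_eq_right (by linarith)]; simp
      simpa [trianglePath, e1, e2] using key (3 * s - 2) c a

/-- The parametrization on the circle `ℝ / Tℤ` of the boundary of the triangle `a, b, c`. -/
def triangleCurve (T : ℝ) [hT : Fact (0 < T)] (a b c : ℂ) : C(AddCircle T, ℂ) where
  toFun := AddCircle.liftIco T 0 fun t => trianglePath a b c (t / T)
  continuous_toFun := by
    apply AddCircle.liftIco_continuous
    · have : T / T = 1 := div_self hT.out.ne'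
      norm_num [trianglePath, this]
    · unfold trianglePath
      fun_prop

theorem triangleCurve_mem (T : ℝ) [hT : Fact (0 < T)] (a b c : ℂ) (x : AddCircle T) :
    triangleCurve T a b c x ∈ segment ℝ a b ∪ segment ℝ b c ∪ segment ℝ c a :=
  trianglePath_mem a b c _

/-- The circumference `2π / 2 ^ n` of the triangles of level `n`. -/
def circumference (n : ℕ) : ℝ := 2 * Real.pi / 2 ^ n

instance circumference_pos (n : ℕ) : Fact (0 < circumference n) :=
  ⟨by unfold circumference; positivity⟩

/-- The triangle `Δ` of level `n = w.length` with index `w`, pointing upwards, parametrized by arc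
length in the counterclockwise direction as a closed curve in the gasket. -/
def deltaLoop (w : HSG) : C(AddCircle (circumference w.length), gasket) where
  toFun x := ⟨cellMap w (triangleCurve _ (corner 0) (corner 1) (corner 2) x), by
    apply cellMap_mem_gasket
    rcases triangleCurve_mem _ (corner 0) (corner 1) (corner 2) x with (h | h) | h
    exacts [segment_corner_subset _ _ h, segment_corner_subset _ _ h, segment_corner_subset _ _ h]⟩
  continuous_toFun :=
    ((continuous_cellMap w).comp (ContinuousMap.continuous _)).subtype_mk _

/-- The triangle `∇` of level `m = w.length + 1` with index `w`, pointing downwards, parametrized by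
arc length in the counterclockwise direction as a closed curve in the gasket. -/
def nablaLoop (w : HSG) : C(AddCircle (circumference (w.length + 1)), gasket) where
  toFun x := ⟨cellMap w (triangleCurve _ (midpt 0 1) (midpt 1 2) (midpt 2 0) x), by
    apply cellMap_mem_gasket
    rcases triangleCurve_mem _ (midpt 0 1) (midpt 1 2) (midpt 2 0) x with (h | h) | h
    exacts [segment_midpt_subset _ _ _ h, segment_midpt_subset _ _ _ h,
      segment_midpt_subset _ _ _ h]⟩
  continuous_toFun :=
    ((continuous_cellMap w).comp (ContinuousMap.continuous _)).subtype_mk _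

/-- The triangle `∇` with index `h` is contained in the triangle `Δ` with index `w`, where `Δ` is
taken together with its interior. -/
def NablaInDelta (h w : HSG) : Prop :=
  Set.range (fun x => (nablaLoop h x : ℂ)) ⊆ convexHull ℝ (Set.range fun x => (deltaLoop w x : ℂ))

/-- The center of the hole bounded by the triangle `∇` with index `w`. -/
def holeCenter (w : HSG) : ℂ := cellMap w ((corner 0 + corner 1 + corner 2) / 3)

/-- The barycentric coordinates with respect to `corner`. -/
def bary (i : Fin 3) (z : ℂ) : ℝ :=
  ![1 - (z.re - z.im / √3) / (2 * Real.pi / 3) - z.im / (Real.pi * √3 / 3),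
    (z.re - z.im / √3) / (2 * Real.pi / 3), z.im / (Real.pi * √3 / 3)] i

theorem bary_corner (i j : Fin 3) : bary i (corner j) = if i = j then 1 else 0 := by
  have : √3 ≠ 0 := by positivity
  fin_cases i <;> fin_cases j <;> simp [bary, corner] <;> field_simp <;> norm_num

theorem bary_combo (i : Fin 3) (z w : ℂ) (a b : ℝ) (hab : a + b = 1) :
    bary i (a • z + b • w) = a * bary i z + b * bary i w := by
  obtain rfl : a = 1 - b := by linarith
  fin_cases i <;> simp [bary] <;> ring

theorem bary_shrink (i j : Fin 3) (z : ℂ) :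
    bary i (shrink j z) = (bary i z + if i = j then 1 else 0) / 2 := by
  have : shrink j z = (1 / 2 : ℝ) • z + (1 / 2 : ℝ) • corner j := by simp [shrink]; ring
  rw [this, bary_combo _ _ _ _ _ (by norm_num), bary_corner]; ring

theorem bary_center (i : Fin 3) : bary i ((corner 0 + corner 1 + corner 2) / 3) = 1 / 3 := by
  have e : (corner 0 + corner 1 + corner 2) / 3 =
      (2 / 3 : ℝ) • ((1 / 2 : ℝ) • corner 0 + (1 / 2 : ℝ) • corner 1) + (1 / 3 : ℝ) • corner 2 := by
    simp; ring
  rw [e, bary_combo _ _ _ _ _ (by norm_num), bary_combo _ _ _ _ _ (by norm_num), bary_corner,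
    bary_corner, bary_corner]
  fin_cases i <;> norm_num [Fin.ext_iff]

theorem bary_nonneg (i : Fin 3) (n : ℕ) {z : ℂ} (hz : z ∈ stage n) : 0 ≤ bary i z := by
  induction n generalizing z with
  | zero =>
    have : convexHull ℝ (Set.range corner) ⊆ {z | 0 ≤ bary i z} := by
      apply convexHull_min
      · rintro _ ⟨j, rfl⟩
        change 0 ≤ bary i (corner j)
        rw [bary_corner]; split_ifs <;> norm_num
      · intro x hx y hy a b ha hb hab
        change 0 ≤ bary i _
        rw [bary_combo _ _ _ _ _ hab]
        exact add_nonneg (mul_nonneg ha hx) (mul_nonneg hb hy)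
    exact this hz
  | succ n ih =>
    obtain ⟨j, y, hy, rfl⟩ := Set.mem_iUnion.1 hz
    have := ih hy
    rw [bary_shrink]; split_ifs <;> linarith

theorem bary_holeCenter_lt (i : Fin 3) (w : HSG) : bary i (holeCenter w) < 1 := by
  induction w with
  | nil =>
    change bary i ((corner 0 + corner 1 + corner 2) / 3) < 1
    rw [bary_center]; norm_num
  | cons j w ih =>
    change bary i (shrink j (holeCenter w)) < 1
    rw [bary_shrink]; split_ifs <;> linarith

theorem holeCenter_notMem_stage (w : HSG) : holeCenter w ∉ stage (w.length + 1) := by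
  induction w with
  | nil =>
    intro h
    obtain ⟨j, y, hy, e⟩ := Set.mem_iUnion.1 h
    have h1 := bary_nonneg j 0 hy
    have h2 := bary_shrink j j y
    rw [e] at h2
    have h3 := bary_center j
    change bary j (holeCenter []) = _ at h3
    rw [h3, if_pos rfl] at h2
    linarith
  | cons i w ih =>
    intro h
    obtain ⟨j, y, hy, e⟩ := Set.mem_iUnion.1 h
    change shrink j y = shrink i (holeCenter w) at e
    by_cases hij : i = j
    · subst hij
      have : y = holeCenter w := by
        unfold shrink at e
        linear_combination 2 * e
      exact ih (this ▸ hy)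
    · have h1 := bary_nonneg j _ hy
      have h2 := bary_shrink j j y
      rw [e, bary_shrink, if_neg (Ne.symm hij), if_pos rfl] at h2
      have h3 := bary_holeCenter_lt j w
      linarith

theorem holeCenter_ne (w : HSG) (z : gasket) : (z : ℂ) - holeCenter w ≠ 0 := by
  intro h
  apply holeCenter_notMem_stage w
  rw [← sub_eq_zero.1 h]
  exact Set.mem_iInter.1 z.2 _

/-- The unitary `z ↦ (z - c) / |z - c|` of `C(SG)`, where `c` is the center of the hole with index
`w`. The classes of these unitaries are the standard generators of `K₁(C(SG))`. -/
def holeUnitary (w : HSG) : unitary C(gasket, ℂ) :=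
  ⟨⟨fun z => ((z : ℂ) - holeCenter w) / (‖(z : ℂ) - holeCenter w‖ : ℂ), by
      refine Continuous.div (by fun_prop) (by fun_prop) fun z => ?_
      exact_mod_cast norm_ne_zero_iff.2 (holeCenter_ne w z)⟩, by
    have h : ∀ z : gasket, (‖(z : ℂ) - holeCenter w‖ : ℂ) ≠ 0 := fun z => by
      exact_mod_cast norm_ne_zero_iff.2 (holeCenter_ne w z)
    rw [Unitary.mem_iff_self_mul_star]
    ext z
    have h1 := Complex.mul_conj' ((z : ℂ) - holeCenter w)
    have h2 := h z
    simp only [ContinuousMap.mul_apply, ContinuousMap.star_apply, ContinuousMap.coe_mk,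
      ContinuousMap.one_apply, Complex.star_def, map_div₀, Complex.conj_ofReal]
    rw [div_mul_div_comm, h1]
    field_simp⟩

/-- The unbounded module `UFM(Δ)` of the upward triangle with index `w`. -/
def deltaUFM (w : HSG) : UnboundedModule gasket := loopModule (deltaLoop w)

/-- The unbounded module `UFM(∇)` of the downward triangle with index `w`. -/
def nablaUFM (w : HSG) : UnboundedModule gasket := loopModule (nablaLoop w)

/-- The winding number of `u` around the upward triangle with index `w`. -/
def deltaWinding (w : HSG) (u : C(gasket, ℂ)) : ℤ := windingNumber (u.comp (deltaLoop w))

/-- The winding number of `u` around the downward triangle with index `w`. -/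
def nablaWinding (w : HSG) (u : C(gasket, ℂ)) : ℤ := windingNumber (u.comp (nablaLoop w))

/-- The identification `Hom(K₁(C(SG)), ℤ) = ∏ ℤ`, with one factor for each hole: a homomorphism is
mapped to the family of its values on the standard generators of `K₁(C(SG))`. -/
def holeCoordinates (Φ : K1 C(gasket, ℂ) →+ ℤ) : HSG → ℤ :=
  fun h => Φ (K1.ofUnitary (holeUnitary h))

end Geometry

end

end Gasket

namespace Gasket

noncomputable section

/-! ### Winding numbers on the circle: multiplicativity, Rouché's theorem, homotopy invariance. -/

section WindingNumbers

variable {T : ℝ}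

/-! Every index map is the homomorphism `windingHom`: wind the determinant along the triangle. That
this is minus the index is the Toeplitz index theorem for matrix symbols. The positive spectral
space of the Dirac operator is the Hardy space (`mem_posSpace_iff`), and compression is
multiplicative as soon as the right factor preserves that space (`UnboundedModule.compression_mul`).
A unitary symbol `U` is written as `W * V` with `V` a trigonometric polynomial matrix near `U` and
`W` so close to `1` that its compression is invertible; `V` times a power of the coordinate `z` is a
polynomial matrix. For polynomial matrices one root of the determinant is split off at a time
(`exists_factor_of_isRoot`), which leaves the scalar symbols `z - a` with `|a| ≠ 1`, that is, the
shift or an invertible operator (`indexFormula_of_unitary`).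

The sum formula is an additivity of winding numbers. The boundary of a cell is homologous to the
boundary of its central hole plus the boundaries of its three subcells, because the inner sides
cancel (`deltaWinding_eq_add_sum`). By uniform continuity a nonvanishing function does not wind
around small triangles (`exists_winding_eq_zero_of_length`), so iterating the identity terminates
and gives a finite sum over the holes in the cell. In terms of words these holes are the extensions
of the word of the cell (`nablaInDelta_iff`).

The values on the generators follow once the generator of one hole is known to wind once around that
hole and not around any other (`nablaWinding_holeUnitary`): a line separates the center of a hole
from the boundary of every other hole. -/

theorem HasWindingNumber.mul {g h : C(AddCircle T, ℂ)} {k l : ℤ} (hk : HasWindingNumber g k)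
    (hl : HasWindingNumber h l) : HasWindingNumber (g * h) (k + l) := by
  obtain ⟨L, hL, hLk⟩ := hk
  obtain ⟨M, hM, hMl⟩ := hl
  refine ⟨L + M, fun t => ?_, ?_⟩
  · simp [Complex.exp_add, hL, hM]
  · simp only [ContinuousMap.add_apply]
    push_cast
    linear_combination hLk + hMl

theorem hasWindingNumber_windingNumber {g : C(AddCircle T, ℂ)} (hg : ∀ x, g x ≠ 0) :
    HasWindingNumber g (windingNumber g) := by
  obtain ⟨k, hk⟩ := exists_hasWindingNumber g hg
  rwa [hk.windingNumber_eq]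

theorem windingNumber_mul {g h : C(AddCircle T, ℂ)} (hg : ∀ x, g x ≠ 0) (hh : ∀ x, h x ≠ 0) :
    windingNumber (g * h) = windingNumber g + windingNumber h :=
  ((hasWindingNumber_windingNumber hg).mul (hasWindingNumber_windingNumber hh)).windingNumber_eq

/-- A closed curve in a half plane whose boundary contains the origin does not wind around it. -/
theorem windingNumber_eq_zero_of_re_pos {g : C(AddCircle T, ℂ)} (α : ℂ)
    (h : ∀ x, 0 < (α * g x).re) : windingNumber g = 0 := by
  apply HasWindingNumber.windingNumber_eq
  have hα : α ≠ 0 := by rintro rfl; simpa using h 0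
  have hs : ∀ t : ℝ, α * g (t : AddCircle T) ∈ Complex.slitPlane := fun t => Or.inl (h _)
  have hc : Continuous fun t : ℝ => α * g (t : AddCircle T) :=
    continuous_const.mul (g.continuous.comp (AddCircle.continuous_mk' T))
  refine ⟨⟨fun t => Complex.log (α * g (t : AddCircle T)) - Complex.log α,
    (hc.clog hs).sub continuous_const⟩, fun t => ?_, ?_⟩
  · have h0 : α * g (t : AddCircle T) ≠ 0 := Complex.slitPlane_ne_zero (hs t)
    simp only [ContinuousMap.coe_mk, Complex.exp_sub, Complex.exp_log h0, Complex.exp_log hα]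
    field_simp
  · simp [AddCircle.coe_period]

theorem windingNumber_const (c : ℂ) :
    windingNumber (ContinuousMap.const (AddCircle T) c) = 0 := by
  by_cases hc : c = 0
  -- The zero function has no logarithm, so its winding number is the default value `0`.
  · rw [windingNumber, dif_neg]
    rintro ⟨k, L, hL, -⟩
    exact Complex.exp_ne_zero _ ((hL 0).trans (by simp [hc]))
  · refine windingNumber_eq_zero_of_re_pos c⁻¹ fun x => ?_
    simp [hc]

theorem windingNumber_one : windingNumber (1 : C(AddCircle T, ℂ)) = 0 :=
  windingNumber_const 1

theorem windingNumber_eq_zero_of_norm_lt {g : C(AddCircle T, ℂ)} (h : ∀ x, ‖g x - 1‖ < 1) :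
    windingNumber g = 0 := by
  refine windingNumber_eq_zero_of_re_pos 1 fun x => ?_
  have h1 := (Complex.abs_re_le_norm (g x - 1)).trans_lt (h x)
  rw [abs_lt, Complex.sub_re, Complex.one_re] at h1
  rw [one_mul]; linarith [h1.1]

/-- Rouché: the quotient `h / g` stays in the open unit disc around `1` and so does not wind around
`0`. -/
theorem windingNumber_eq_of_norm_lt {g h : C(AddCircle T, ℂ)} (hg : ∀ x, g x ≠ 0)
    (hgh : ∀ x, ‖h x - g x‖ < ‖g x‖) : windingNumber h = windingNumber g := by
  have hc : Continuous fun x => h x / g x := h.continuous.div g.continuous hg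
  have e : h = ⟨_, hc⟩ * g := by
    ext x; simp [hg x]
  have hn : ∀ x, ‖h x / g x - 1‖ < 1 := fun x => by
    rw [div_sub_one (hg x), norm_div, div_lt_one (norm_pos_iff.2 (hg x))]
    exact hgh x
  rw [e, windingNumber_mul _ hg, windingNumber_eq_zero_of_norm_lt hn, zero_add]
  intro x hx
  have h1 := hn x
  rw [show h x / g x = 0 from hx] at h1
  simp at h1

theorem norm_fourier_apply (n : ℤ) (x : AddCircle T) : ‖fourier n x‖ = 1 := by
  rw [fourier_apply]; exact Circle.norm_coe _

theorem fourier_neg_one_mul_fourier_one : (fourier (-1) * fourier 1 : C(AddCircle T, ℂ)) = 1 := by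
  ext t
  rw [ContinuousMap.mul_apply, ← fourier_add, neg_add_cancel, fourier_zero]
  rfl

theorem fourier_one_sub_ne_zero {a : ℂ} (ha : ‖a‖ ≠ 1) (x : AddCircle T) :
    fourier 1 x - a ≠ 0 := by
  intro h
  rw [sub_eq_zero] at h
  exact ha (by rw [← h, norm_fourier_apply])

variable [hT : Fact (0 < T)]

/-- The winding number is constant along a path of curves avoiding the origin. -/
theorem windingNumber_eq_of_path {g : unitInterval → C(AddCircle T, ℂ)} (hg : Continuous g)
    (h0 : ∀ s x, g s x ≠ 0) : windingNumber (g 0) = windingNumber (g 1) := by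
  have : IsLocallyConstant fun s => windingNumber (g s) := by
    rw [IsLocallyConstant.iff_eventually_eq]
    intro s
    -- The minimum of `‖g s‖` over the compact circle is a radius within which Rouché applies
    -- uniformly.
    obtain ⟨x₀, -, hx₀⟩ := isCompact_univ.exists_isMinOn Set.univ_nonempty
      ((g s).continuous.norm.continuousOn)
    have hpos : 0 < ‖g s x₀‖ := norm_pos_iff.2 (h0 s x₀)
    filter_upwards [Metric.continuous_iff'.1 hg s _ hpos] with t ht
    refine windingNumber_eq_of_norm_lt (h0 s) fun x => ?_
    calc ‖g t x - g s x‖ ≤ dist (g t) (g s) := by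
          rw [← dist_eq_norm]; exact ContinuousMap.dist_apply_le_dist x
      _ < ‖g s x₀‖ := ht
      _ ≤ ‖g s x‖ := hx₀ (Set.mem_univ x)
  exact this.apply_eq_of_preconnectedSpace 0 1

theorem windingNumber_fourier_one : windingNumber (fourier 1 : C(AddCircle T, ℂ)) = 1 := by
  have hT0 : (T : ℂ) ≠ 0 := by exact_mod_cast hT.out.ne'
  apply HasWindingNumber.windingNumber_eq
  refine ⟨⟨fun t => 2 * Real.pi * Complex.I * t / T, by fun_prop⟩, fun t => ?_, ?_⟩
  · rw [fourier_coe_apply]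
    simp
  · simp [hT0]

/-- Rouché against the dominant term: the coordinate if `‖a‖ < 1`, the constant `-a` if `‖a‖ > 1`.
-/
theorem windingNumber_fourier_one_sub {a : ℂ} (ha : ‖a‖ ≠ 1) :
    windingNumber (fourier 1 - ContinuousMap.const (AddCircle T) a) = if ‖a‖ < 1 then 1 else 0 := by
  split_ifs with h
  · refine (windingNumber_eq_of_norm_lt (g := fourier 1) (fun x => ?_) fun x => ?_).trans
      windingNumber_fourier_one
    · rw [← norm_pos_iff, norm_fourier_apply]; exact one_pos
    · rw [norm_fourier_apply]
      simpa using h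
  · have h1 : 1 < ‖a‖ := lt_of_le_of_ne (not_lt.1 h) ha.symm
    have h2 : a ≠ 0 := norm_pos_iff.1 (one_pos.trans h1)
    refine (windingNumber_eq_of_norm_lt (g := ContinuousMap.const _ (-a)) (fun x => ?_)
      fun x => ?_).trans (windingNumber_const _)
    · simpa using h2
    · rw [ContinuousMap.sub_apply, ContinuousMap.const_apply, ContinuousMap.const_apply,
        sub_neg_eq_add, sub_add_cancel, norm_fourier_apply, norm_neg]
      exact h1

end WindingNumbers

/-! ### The winding number of the determinant as a homomorphism on `K₁`. -/

section IndexHom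

variable {T : ℝ} {X : Type} [TopologicalSpace X]

theorem det_pad {A : Type*} [CommRing A] {m n : ℕ} (h : m ≤ n) (u : Matrix (Fin m) (Fin m) A) :
    (pad h u).det = u.det := by
  rw [pad, Matrix.det_submatrix_equiv_self, Matrix.det_fromBlocks_zero₂₁, Matrix.det_one, mul_one]

theorem det_unitary_apply_ne_zero {n : ℕ} (u : Matrix.unitaryGroup (Fin n) C(X, ℂ)) (x : X) :
    u.1.det x ≠ 0 := by
  intro h
  have h1 := congrArg Matrix.det (Matrix.mem_unitaryGroup_iff.1 u.2)
  rw [Matrix.det_mul, Matrix.det_one] at h1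
  have h2 := DFunLike.congr_fun h1 x
  rw [ContinuousMap.mul_apply, h] at h2
  simp at h2

/-- The winding number along `γ` of the determinant of a unitary matrix. -/
def detWinding (γ : C(AddCircle T, X)) (n : ℕ) :
    Matrix.unitaryGroup (Fin n) C(X, ℂ) →* Multiplicative ℤ where
  toFun u := Multiplicative.ofAdd (windingNumber (u.1.det.comp γ))
  map_one' := by
    simp only [OneMemClass.coe_one, Matrix.det_one, ofAdd_eq_one]
    exact windingNumber_one
  map_mul' u v := by
    rw [← ofAdd_add, Submonoid.coe_mul, Matrix.det_mul, ContinuousMap.mul_comp, windingNumber_mul]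
    · exact fun x => det_unitary_apply_ne_zero u _
    · exact fun x => det_unitary_apply_ne_zero v _

theorem stableDetWinding_compat (γ : C(AddCircle T, X)) (m n : ℕ) (h : m ≤ n)
    (u : Matrix.unitaryGroup (Fin m) C(X, ℂ)) :
    detWinding γ m u = detWinding γ n (padHom C(X, ℂ) m n h u) := by
  simp only [detWinding, MonoidHom.coe_mk, OneHom.coe_mk, padHom, det_pad]

/-- The winding number of the determinant on the stable unitary group. -/
def stableDetWinding (γ : C(AddCircle T, X)) : StableUnitary C(X, ℂ) →* Multiplicative ℤ where
  toFun := DirectLimit.lift _ (fun n u => detWinding γ n u) (stableDetWinding_compat γ)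
  map_one' := DirectLimit.lift_one (fun n => detWinding γ n) (stableDetWinding_compat γ)
  map_mul' x y := DirectLimit.lift_mul (fun n => detWinding γ n) (stableDetWinding_compat γ) x y

variable [hT : Fact (0 < T)] [LocallyCompactSpace X]

/-- Along a path of unitary matrices the determinant never vanishes, so its winding number cannot
jump. This lets the homomorphism descend to `K₁`. -/
theorem detWinding_eq_one_of_joined (γ : C(AddCircle T, X)) {n : ℕ}
    {u : Matrix.unitaryGroup (Fin n) C(X, ℂ)} (h : Joined 1 u) : detWinding γ n u = 1 := by
  rw [← map_one (detWinding γ n)]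
  have hc : Continuous fun s => ((h.somePath s).1.det).comp γ :=
    (ContinuousMap.continuous_precomp γ).comp
      ((continuous_subtype_val.comp h.somePath.continuous).matrix_det)
  have := windingNumber_eq_of_path hc fun s x => det_unitary_apply_ne_zero _ _
  simp only [Path.source, Path.target] at this
  exact congrArg Multiplicative.ofAdd this.symm

/-- The homomorphism `K₁(C(X)) → ℤ` that maps a class `[u]` to the winding number of `det u`
along `γ`. -/
def windingHom (γ : C(AddCircle T, X)) : K1 C(X, ℂ) →+ ℤ :=
  MonoidHom.toAdditiveLeft <| QuotientGroup.lift (nullHomotopic C(X, ℂ)) (stableDetWinding γ) <| by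
    rintro _ ⟨n, u, rfl, hu⟩
    exact detWinding_eq_one_of_joined γ hu

theorem windingHom_mk (γ : C(AddCircle T, X)) {n : ℕ} (u : Matrix.unitaryGroup (Fin n) C(X, ℂ)) :
    windingHom γ (K1.mk u) = windingNumber (u.1.det.comp γ) :=
  rfl

theorem windingHom_ofUnitary (γ : C(AddCircle T, X)) (u : unitary C(X, ℂ)) :
    windingHom γ (K1.ofUnitary u) = windingNumber ((u : C(X, ℂ)).comp γ) := by
  rw [K1.ofUnitary, windingHom_mk]
  simp [oneByOne]

end IndexHom

end

end Gasket

namespace Gasket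

noncomputable section

/-! ### Additivity of the Fredholm index. -/

section FredholmIndex

open ContinuousLinearMap Module

variable {E F G : Type*} [NormedAddCommGroup E] [NormedSpace ℂ E] [NormedAddCommGroup F]
  [NormedSpace ℂ F] [NormedAddCommGroup G] [NormedSpace ℂ G]

theorem isFredholm_comp {S : F →L[ℂ] G} {T : E →L[ℂ] F} (hS : S.IsFredholm) (hT : T.IsFredholm) :
    (S ∘L T).IsFredholm := by
  obtain ⟨S', hS'⟩ := hS.exists_isQuasiInverse
  obtain ⟨T', hT'⟩ := hT.exists_isQuasiInverse
  exact IsFredholm.of_isQuasiInverse (v := T' ∘L S') (hT'.comp hS')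

/-- If `R` inverts `S T` up to finite rank, then `T R` inverts `S` on both sides up to finite rank;
one side uses a quasi-inverse of `T`. This later cancels an analytic factor on the right. -/
theorem isFredholm_of_comp_left {S : F →L[ℂ] G} {T : E →L[ℂ] F} (hT : T.IsFredholm)
    (hST : (S ∘L T).IsFredholm) : S.IsFredholm := by
  obtain ⟨T', hT'⟩ := hT.exists_isQuasiInverse
  obtain ⟨R, hR⟩ := hST.exists_isQuasiInverse
  exact IsFredholm.of_isQuasiInverse (v := T ∘L R) (LinearMap.IsQuasiInverse.of_comp_left hT' hR)

/-- Rank-nullity for `t` restricted to the kernel of `s ∘ t`, whose image is `s.ker ⊓ t.range`. -/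
theorem finrank_ker_comp (s : F →ₗ[ℂ] G) (t : E →ₗ[ℂ] F) [FiniteDimensional ℂ (s ∘ₗ t).ker] :
    finrank ℂ (s ∘ₗ t).ker = finrank ℂ t.ker + finrank ℂ (s.ker ⊓ t.range : Submodule ℂ F) := by
  have hle : t.ker ≤ (s ∘ₗ t).ker := fun x hx => by
    rw [LinearMap.mem_ker] at hx
    simp [hx]
  have h := (t.domRestrict (s ∘ₗ t).ker).finrank_range_add_finrank_ker
  have e1 : (t.domRestrict (s ∘ₗ t).ker).range = s.ker ⊓ t.range := by
    rw [LinearMap.range_domRestrict, LinearMap.ker_comp, Submodule.map_comap_eq, inf_comm]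
  have e2 : (t.domRestrict (s ∘ₗ t).ker).ker = t.ker.comap (s ∘ₗ t).ker.subtype := by
    rw [LinearMap.ker_domRestrict]
  rw [e1, e2, (Submodule.comapSubtypeEquivOfLe hle).finrank_eq] at h
  omega

/-- The map `m` from coker `t` to coker `s ∘ t` induced by `s` has cokernel coker `s`, and its
kernel is the image of `s.ker` in coker `t`, that is, `s.ker` modulo `s.ker ⊓ t.range`. That
intersection also occurs in the kernel formula and drops out of the index. -/
theorem finrank_coker_comp (s : F →ₗ[ℂ] G) (t : E →ₗ[ℂ] F) [FiniteDimensional ℂ s.ker]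
    [FiniteDimensional ℂ (F ⧸ t.range)] [FiniteDimensional ℂ (G ⧸ (s ∘ₗ t).range)] :
    finrank ℂ (G ⧸ (s ∘ₗ t).range) + finrank ℂ s.ker = finrank ℂ (F ⧸ t.range) +
      finrank ℂ (G ⧸ s.range) + finrank ℂ (s.ker ⊓ t.range : Submodule ℂ F) := by
  have hle : t.range ≤ (s ∘ₗ t).range.comap s := by
    rintro _ ⟨x, rfl⟩
    exact ⟨x, rfl⟩
  let m := t.range.mapQ (s ∘ₗ t).range s hle
  let n := t.range.mkQ.domRestrict s.ker
  have hm := m.finrank_range_add_finrank_ker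
  have hn := n.finrank_range_add_finrank_ker
  have hq := m.range.finrank_quotient_add_finrank
  have e1 : n.range = m.ker := by
    rw [LinearMap.range_domRestrict, Submodule.ker_mapQ]
    ext y
    simp only [Submodule.mem_map]
    constructor
    · rintro ⟨x, hx, rfl⟩
      exact ⟨x, ⟨0, by simpa using hx.symm⟩, rfl⟩
    · rintro ⟨x, ⟨z, hz⟩, rfl⟩
      refine ⟨x - t z, ?_, ?_⟩
      · rw [LinearMap.mem_ker, map_sub, sub_eq_zero]
        exact hz.symm
      · rw [map_sub, sub_eq_self, Submodule.mkQ_apply, Submodule.Quotient.mk_eq_zero]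
        exact ⟨z, rfl⟩
  have e2 : n.ker = (s.ker ⊓ t.range : Submodule ℂ F).comap s.ker.subtype := by
    ext x
    simp [n]
  have e3 : m.range = s.range.map (s ∘ₗ t).range.mkQ := by
    rw [Submodule.range_mapQ]
  have hle' : (s ∘ₗ t).range ≤ s.range := LinearMap.range_comp_le_range _ _
  rw [e3, (Submodule.quotientQuotientEquivQuotient _ _ hle').finrank_eq, ← e3] at hq
  rw [e1, e2, (Submodule.comapSubtypeEquivOfLe inf_le_left).finrank_eq] at hn
  omega

theorem fredholmIndex_comp {S : F →L[ℂ] G} {T : E →L[ℂ] F} (hS : S.IsFredholm)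
    (hT : T.IsFredholm) : fredholmIndex (S ∘L T) = fredholmIndex S + fredholmIndex T := by
  have hST := isFredholm_comp hS hT
  have i1 : FiniteDimensional ℂ (S.toLinearMap ∘ₗ T.toLinearMap).ker := hST.finite_ker
  have i2 : FiniteDimensional ℂ S.toLinearMap.ker := hS.finite_ker
  have i3 : FiniteDimensional ℂ (F ⧸ T.toLinearMap.range) := hT.finite_coker
  have i4 : FiniteDimensional ℂ (G ⧸ (S.toLinearMap ∘ₗ T.toLinearMap).range) := hST.finite_coker
  have h1 := finrank_ker_comp S.toLinearMap T.toLinearMap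
  have h2 := finrank_coker_comp S.toLinearMap T.toLinearMap
  change (finrank ℂ (S.toLinearMap ∘ₗ T.toLinearMap).ker : ℤ) -
    (finrank ℂ (G ⧸ (S.toLinearMap ∘ₗ T.toLinearMap).range) : ℤ) = _
  unfold fredholmIndex
  zify at h1 h2
  linear_combination h1 - h2

theorem isFredholm_of_isUnit {T : E →L[ℂ] E} (hT : IsUnit T) : T.IsFredholm := by
  obtain ⟨u, rfl⟩ := hT
  exact IsFredholm.of_isQuasiInverse (ContinuousLinearEquiv.ofUnit u).toLinearEquiv.isQuasiInverse

theorem fredholmIndex_of_isUnit {T : E →L[ℂ] E} (hT : IsUnit T) : fredholmIndex T = 0 := by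
  obtain ⟨u, rfl⟩ := hT
  have h1 : (u : E →L[ℂ] E).ker = ⊥ :=
    LinearMap.ker_eq_bot.2 (ContinuousLinearEquiv.ofUnit u).injective
  have h2 : (u : E →L[ℂ] E).range = ⊤ :=
    LinearMap.range_eq_top.2 (ContinuousLinearEquiv.ofUnit u).surjective
  rw [fredholmIndex, h1, h2, finrank_bot, finrank_zero_of_subsingleton]
  simp

/-- An operator with a left inverse whose range is the kernel of a nonzero functional has
index `-1`. -/
theorem isFredholm_of_range_eq_ker {S L : E →L[ℂ] E} {φ : E →ₗ[ℂ] ℂ} (hL : ∀ x, L (S x) = x)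
    (hS : ∀ x, φ (S x) = 0) (hφ : ∀ y, φ y = 0 → S (L y) = y) (hne : ∃ y, φ y ≠ 0) :
    S.IsFredholm ∧ fredholmIndex S = -1 := by
  have hsurj : Function.Surjective φ := φ.surjective fun h => by
    obtain ⟨y, hy⟩ := hne
    exact hy (by simp [h])
  have e := φ.quotKerEquivOfSurjective hsurj
  have hr : S.range = φ.ker := by
    ext y
    exact ⟨fun ⟨x, hx⟩ => hx ▸ hS x, fun hy => ⟨L y, hφ y hy⟩⟩
  constructor
  · have : IsNoetherian ℂ (E ⧸ φ.ker) := isNoetherian_of_linearEquiv e.symm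
    apply IsFredholm.of_isQuasiInverse (v := L)
    constructor
    · have : L.toLinearMap ∘ₗ S.toLinearMap = LinearMap.id := by ext x; exact hL x
      rw [LinearMap.IsLeftQuasiInverse, this]
    -- `S ∘ L` is the identity on a hyperplane, hence differs from the identity by an operator of
    -- finite rank.
    · exact LinearMap.FiniteRangeSetoid.equiv_of_eqOn_of_isNoetherian φ.ker fun y hy => hφ y hy
  · have hk : S.ker = ⊥ := LinearMap.ker_eq_bot.2 (Function.LeftInverse.injective hL)
    rw [fredholmIndex, hk, hr, e.finrank_eq]
    simp

end FredholmIndex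

end

end Gasket

namespace Gasket

noncomputable section

/-! ### Compressions to the positive spectral space, and symbols that leave it invariant. -/

section Compressions

variable {X : Type} [TopologicalSpace X] (M : UnboundedModule X)

/-- The functions whose multiplication operators leave the range of the spectral projection
`E([0, ∞[)` invariant. -/
def UnboundedModule.analytic : Subalgebra ℂ C(X, ℂ) where
  carrier := {f | ∀ x ∈ M.posSpace, M.rep f x ∈ M.posSpace}
  mul_mem' := by
    intro f g hf hg x hx
    rw [map_mul]
    exact hf _ (hg x hx)
  add_mem' := by
    intro f g hf hg x hx
    rw [map_add]
    exact M.posSpace.add_mem (hf x hx) (hg x hx)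
  algebraMap_mem' := by
    intro c x hx
    rw [AlgHomClass.commutes, Algebra.algebraMap_eq_smul_one]
    exact M.posSpace.smul_mem c hx

theorem UnboundedModule.compression_one : M.compression 1 = 1 := by
  ext x
  simp [compression]

theorem UnboundedModule.compression_add (f g : C(X, ℂ)) :
    M.compression (f + g) = M.compression f + M.compression g := by
  ext x
  simp [compression]

theorem UnboundedModule.compression_zero : M.compression 0 = 0 := by
  ext x
  simp [compression]

theorem UnboundedModule.compression_smul (c : ℂ) (f : C(X, ℂ)) :
    M.compression (c • f) = c • M.compression f := by
  ext x
  simp [compression]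

theorem UnboundedModule.compression_sum {ι : Type*} (s : Finset ι) (f : ι → C(X, ℂ)) :
    M.compression (∑ i ∈ s, f i) = ∑ i ∈ s, M.compression (f i) :=
  map_sum (AddMonoidHom.mk' M.compression M.compression_add) f s

theorem UnboundedModule.coe_compression_apply {f : C(X, ℂ)} (hf : f ∈ M.analytic)
    (x : M.posSpace) : (M.compression f x : M.H) = M.rep f x :=
  congrArg Subtype.val
    (M.posSpace.orthogonalProjectionOnto_mem_subspace_eq_self ⟨M.rep f x, hf x x.2⟩)

/-- `g` acts first and already stays in the positive space, so the projection between the two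
factors does nothing. Only the right factor has to be analytic. -/
theorem UnboundedModule.compression_mul (f : C(X, ℂ)) {g : C(X, ℂ)} (hg : g ∈ M.analytic) :
    M.compression (f * g) = M.compression f * M.compression g := by
  ext1 x
  change M.posSpace.orthogonalProjectionOnto (M.rep (f * g) x) =
    M.posSpace.orthogonalProjectionOnto (M.rep f (M.compression g x : M.H))
  rw [M.coe_compression_apply hg, map_mul]
  rfl

theorem UnboundedModule.norm_compression_le [CompactSpace X] (f : C(X, ℂ)) :
    ‖M.compression f‖ ≤ ‖f‖ := by
  have h1 := M.posSpace.orthogonalProjectionOnto_norm_le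
  have h2 := NonUnitalStarAlgHom.norm_apply_le M.rep f
  have h3 := M.posSpace.norm_subtypeL_le
  calc ‖M.compression f‖ ≤ ‖M.posSpace.orthogonalProjectionOnto‖ *
        (‖M.rep f‖ * ‖M.posSpace.subtypeL‖) :=
      (ContinuousLinearMap.opNorm_comp_le _ _).trans
        (mul_le_mul_of_nonneg_left (ContinuousLinearMap.opNorm_comp_le _ _) (norm_nonneg _))
    _ ≤ 1 * (‖f‖ * 1) := by gcongr
    _ = ‖f‖ := by ring

theorem UnboundedModule.continuous_compression [CompactSpace X] : Continuous M.compression :=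
  AddMonoidHomClass.continuous_of_bound (AddMonoidHom.mk' M.compression M.compression_add) 1
    fun f => by simpa using M.norm_compression_le f

/-- Neumann series, since compression does not increase norms. -/
theorem UnboundedModule.isUnit_compression_one_sub [CompactSpace X] {f : C(X, ℂ)} (hf : ‖f‖ < 1) :
    IsUnit (M.compression (1 - f)) := by
  have h : M.compression (1 - f) = 1 - M.compression f := by
    rw [eq_sub_iff_add_eq, ← compression_add, sub_add_cancel, compression_one]
  rw [h]
  exact isUnit_one_sub_of_norm_lt_one (R := M.posSpace →L[ℂ] M.posSpace)
    ((M.norm_compression_le f).trans_lt hf)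

variable {n : ℕ}

theorem UnboundedModule.matrixCompression_apply (u : Matrix (Fin n) (Fin n) C(X, ℂ))
    (x : Fin n → M.posSpace) (i : Fin n) :
    M.matrixCompression u x i = ∑ j, M.compression (u i j) (x j) := by
  simp [matrixCompression]

theorem UnboundedModule.matrixCompression_diagonal_apply (d : Fin n → C(X, ℂ))
    (x : Fin n → M.posSpace) (i : Fin n) :
    M.matrixCompression (Matrix.diagonal d) x i = M.compression (d i) (x i) := by
  rw [matrixCompression_apply, Finset.sum_eq_single i]
  · rw [Matrix.diagonal_apply_eq]
  · intro j _ hj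
    rw [Matrix.diagonal_apply_ne _ hj.symm, compression_zero]
    rfl
  · simp

theorem UnboundedModule.matrixCompression_one :
    M.matrixCompression (1 : Matrix (Fin n) (Fin n) C(X, ℂ)) = 1 := by
  ext1 x
  funext i
  rw [← Matrix.diagonal_one, matrixCompression_diagonal_apply, compression_one]
  rfl

theorem UnboundedModule.matrixCompression_mul (u : Matrix (Fin n) (Fin n) C(X, ℂ))
    {v : Matrix (Fin n) (Fin n) C(X, ℂ)} (hv : ∀ i j, v i j ∈ M.analytic) :
    M.matrixCompression (u * v) = M.matrixCompression u * M.matrixCompression v := by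
  ext1 x
  funext i
  rw [mul_apply_eq_comp, matrixCompression_apply, matrixCompression_apply]
  simp only [matrixCompression_apply, Matrix.mul_apply, compression_sum, map_sum,
    sum_apply]
  rw [Finset.sum_comm]
  refine Finset.sum_congr rfl fun j _ => Finset.sum_congr rfl fun k _ => ?_
  rw [M.compression_mul _ (hv _ _)]
  rfl

theorem UnboundedModule.continuous_matrixCompression [CompactSpace X] :
    Continuous fun u : Matrix (Fin n) (Fin n) C(X, ℂ) => M.matrixCompression u := by
  -- As a finite sum of single matrix entries the operator depends continuously on `u` because each
  -- entry does.
  have e : (fun u : Matrix (Fin n) (Fin n) C(X, ℂ) => M.matrixCompression u) = fun u =>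
      ∑ i, ∑ j, ContinuousLinearMap.single ℂ (fun _ => M.posSpace) i ∘L
        (M.compression (u i j) ∘L ContinuousLinearMap.proj j) := by
    funext u
    ext1 x
    funext k
    rw [matrixCompression_apply]
    simp only [sum_apply, Finset.sum_apply]
    refine Eq.symm ((Finset.sum_eq_single k ?_ ?_).trans ?_)
    · intro i _ hi
      exact Finset.sum_eq_zero fun j _ => Pi.single_eq_of_ne hi.symm _
    · simp
    · simp
  rw [e]
  refine continuous_finsetSum _ fun i _ => continuous_finsetSum _ fun j _ => ?_
  exact continuous_const.clm_comp
    ((M.continuous_compression.comp (continuous_id.matrix_elem i j)).clm_comp continuous_const)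

theorem UnboundedModule.isUnit_matrixCompression_diagonal {d : Fin n → C(X, ℂ)}
    (hd : ∀ i, IsUnit (M.compression (d i))) :
    IsUnit (M.matrixCompression (Matrix.diagonal d)) := by
  choose r hr using hd
  refine ⟨⟨M.matrixCompression (Matrix.diagonal d), ContinuousLinearMap.pi fun i =>
    (r i).inv ∘L ContinuousLinearMap.proj i, ?_, ?_⟩, rfl⟩
  · ext1 x
    funext i
    rw [mul_apply_eq_comp, matrixCompression_diagonal_apply, ← hr i]
    exact DFunLike.congr_fun (r i).val_inv (x i)
  · ext1 x
    funext i
    change (r i).inv (M.matrixCompression (Matrix.diagonal d) x i) = x i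
    rw [matrixCompression_diagonal_apply, ← hr i]
    exact DFunLike.congr_fun (r i).inv_val (x i)

end Compressions

end

end Gasket

namespace Gasket

noncomputable section

/-! ### The module of the circle: Fourier coefficients, Hardy space and shift. -/

section CircleModule

open MeasureTheory AddCircle

variable (T : ℝ) [hT : Fact (0 < T)]

/-- The unbounded module of the circle over the continuous functions on the circle. -/
abbrev circleModule : UnboundedModule (AddCircle T) := loopModule (ContinuousMap.id _)

variable {T}

/-- The two modules share the Hilbert space and the Dirac operator; only the representation is
pulled back. All index computations can thus be made on the circle itself. -/
theorem matrixCompression_loopModule {X : Type} [TopologicalSpace X] (γ : C(AddCircle T, X))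
    {n : ℕ} (u : Matrix (Fin n) (Fin n) C(X, ℂ)) :
    (loopModule γ).matrixCompression u =
      (circleModule T).matrixCompression (u.map fun f => f.comp γ) :=
  rfl

/-- The `k`-th Fourier coefficient, as a functional on `L²` of the circle. -/
def coeffL (k : ℤ) : CircleL2 T →L[ℂ] ℂ :=
  lp.evalCLM ℂ (fun _ : ℤ => ℂ) 2 k ∘L
    (fourierBasis (T := T)).repr.toContinuousLinearEquiv.toContinuousLinearMap

theorem coeffL_apply (k : ℤ) (x : CircleL2 T) : coeffL k x = fourierBasis.repr x k :=
  rfl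

theorem coeffL_ext {x y : CircleL2 T} (h : ∀ k, coeffL k x = coeffL k y) : x = y :=
  fourierBasis.repr.injective (lp.ext (funext h))

theorem coeffL_circleDirac (x : circleDomain T) (k : ℤ) :
    coeffL k (circleDirac T x) = (circleEigenvalue T k : ℂ) * coeffL k (x : CircleL2 T) := by
  rw [coeffL_apply, coeffL_apply]
  simp [circleDirac]

/-- For an integer `k < 0` even `k + 1/2` is negative, so the summand `1/2` does not move the cut
between negative and nonnegative frequencies. -/
theorem circleEigenvalue_neg_iff (k : ℤ) : circleEigenvalue T k < 0 ↔ k < 0 := by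
  have h : 0 < T / (2 * Real.pi) := div_pos hT.out (by positivity)
  rw [circleEigenvalue, div_neg_iff]
  constructor
  · rintro (⟨-, h2⟩ | ⟨h1, -⟩)
    · linarith
    · by_contra hk
      have : (0 : ℝ) ≤ k := by exact_mod_cast not_lt.1 hk
      linarith
  · intro hk
    have : (k : ℝ) ≤ -1 := by exact_mod_cast Int.le_sub_one_of_lt hk
    exact Or.inr ⟨by linarith, h⟩

theorem coeffL_fourierLp (j k : ℤ) :
    coeffL k (fourierLp (T := T) 2 j) = if k = j then 1 else 0 := by
  rw [coeffL_apply, ← coe_fourierBasis, HilbertBasis.repr_self, lp.single_apply]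
  by_cases h : k = j
  · subst h; simp
  · simp [h]

theorem fourierLp_mem_circleDomain (j : ℤ) : fourierLp (T := T) 2 j ∈ circleDomain T := by
  have e : (fun k : ℤ => (circleEigenvalue T k : ℂ) * coeffL k (fourierLp (T := T) 2 j)) =
      (circleEigenvalue T j : ℂ) • fun k : ℤ => coeffL k (fourierLp (T := T) 2 j) := by
    funext k
    rw [Pi.smul_apply, coeffL_fourierLp]
    by_cases h : k = j
    · subst h; simp
    · simp [h]
  change Memℓp (fun k : ℤ => (circleEigenvalue T k : ℂ) * coeffL k (fourierLp (T := T) 2 j)) 2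
  rw [e]
  exact (lp.memℓp (fourierBasis.repr (fourierLp (T := T) 2 j))).const_smul _

theorem circleDirac_fourierLp (j : ℤ) :
    circleDirac T ⟨fourierLp 2 j, fourierLp_mem_circleDomain j⟩ =
      (circleEigenvalue T j : ℂ) • fourierLp (T := T) 2 j := by
  refine coeffL_ext fun k => ?_
  refine (coeffL_circleDirac _ k).trans ?_
  rw [map_smul, coeffL_fourierLp]
  by_cases h : k = j
  · subst h; simp
  · simp [h]

theorem coeffL_mulOp_fourier (m k : ℤ) (x : CircleL2 T) :
    coeffL k (mulOp T (fourier m) x) = coeffL (k - m) x := by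
  rw [coeffL_apply, coeffL_apply, fourierBasis_repr, fourierBasis_repr, fourierCoeff,
    fourierCoeff]
  apply integral_congr_ae
  filter_upwards [coeFn_mulCLM T (fourier m) x] with t ht
  rw [show (mulOp T (fourier m) x : AddCircle T → ℂ) t = fourier m t * x t from ht,
    smul_eq_mul, smul_eq_mul, ← mul_assoc, ← fourier_add]
  congr 3
  ring

/-- The `k`-th Fourier coefficient, as a functional on the Hilbert space of the module. -/
def coeff (k : ℤ) : (circleModule T).H →L[ℂ] ℂ :=
  (coeffL k : CircleL2 T →L[ℂ] ℂ)

theorem coeff_ext {x y : (circleModule T).H} (h : ∀ k, coeff k x = coeff k y) : x = y :=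
  coeffL_ext (T := T) h

theorem coeff_rep_fourier (m k : ℤ) (x : (circleModule T).H) :
    coeff k ((circleModule T).rep (fourier m) x) = coeff (k - m) x :=
  coeffL_mulOp_fourier m k x

/-- Comparing `k`-th coefficients in the eigenvalue equation gives `(μ - λₖ) * coeff k y = 0` with
`λₖ < 0 ≤ μ`. -/
theorem coeff_eq_zero_of_eigenvector {k : ℤ} (hk : k < 0) {y : (circleModule T).H} {μ : ℝ}
    (hμ : 0 ≤ μ) (hy : y ∈ (circleModule T).dirac.domain)
    (h : (circleModule T).dirac ⟨y, hy⟩ = (μ : ℂ) • y) : coeff k y = 0 := by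
  have h1 : coeff k ((circleModule T).dirac ⟨y, hy⟩) = (circleEigenvalue T k : ℂ) * coeff k y :=
    coeffL_circleDirac ⟨y, hy⟩ k
  rw [h, map_smul, smul_eq_mul] at h1
  have h2 : ((μ - circleEigenvalue T k : ℝ) : ℂ) * coeff k y = 0 := by
    push_cast
    linear_combination h1
  refine (mul_eq_zero.1 h2).resolve_left ?_
  have := (circleEigenvalue_neg_iff (T := T) k).2 hk
  exact_mod_cast (by linarith : 0 < μ - circleEigenvalue T k).ne'

theorem fourierLp_mem_posSpace {j : ℤ} (hj : 0 ≤ j) :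
    (show (circleModule T).H from fourierLp (T := T) 2 j) ∈ (circleModule T).posSpace := by
  refine Submodule.le_topologicalClosure _ (Submodule.subset_span ?_)
  refine ⟨circleEigenvalue T j, ?_, fourierLp_mem_circleDomain j, circleDirac_fourierLp j⟩
  rw [← not_lt, circleEigenvalue_neg_iff]
  exact not_lt.2 hj

/-- The range of the positive spectral projection is the Hardy space. -/
theorem mem_posSpace_iff (x : (circleModule T).H) :
    x ∈ (circleModule T).posSpace ↔ ∀ k < 0, coeff k x = 0 := by
  constructor
  · intro hx k hk
    have hle : (circleModule T).posSpace ≤ (coeff (T := T) k).ker := by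
      refine Submodule.topologicalClosure_minimal _ (Submodule.span_le.2 ?_)
        (coeff (T := T) k).isClosed_ker
      rintro y ⟨μ, hμ, hy, h⟩
      exact coeff_eq_zero_of_eigenvector hk hμ hy h
    exact hle hx
  · intro h
    have hc : IsClosed ((circleModule T).posSpace : Set (circleModule T).H) :=
      Submodule.isClosed_topologicalClosure _
    -- `x` is the limit of its Fourier sums, which involve only frequencies `k ≥ 0` and so lie in
    -- the closed space.
    have hs : HasSum (fun k : ℤ => coeff k x •
        (show (circleModule T).H from fourierLp (T := T) 2 k)) x := by
      have := (fourierBasis (T := T)).hasSum_repr x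
      rwa [coe_fourierBasis] at this
    refine hc.mem_of_tendsto hs (Filter.Eventually.of_forall fun s => ?_)
    refine Submodule.sum_mem _ fun k _ => ?_
    by_cases hk : k < 0
    · rw [h k hk, zero_smul]
      exact Submodule.zero_mem _
    · exact Submodule.smul_mem _ _ (fourierLp_mem_posSpace (not_lt.1 hk))

theorem fourier_mem_analytic {m : ℤ} (hm : 0 ≤ m) : fourier m ∈ (circleModule T).analytic := by
  intro x hx
  rw [mem_posSpace_iff] at hx ⊢
  intro k hk
  rw [coeff_rep_fourier]
  exact hx _ (by lia)

theorem coeff_compression_fourier {m : ℤ} (hm : 0 ≤ m) (x : (circleModule T).posSpace) (k : ℤ) :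
    coeff k ((circleModule T).compression (fourier m) x : (circleModule T).H) =
      coeff (k - m) (x : (circleModule T).H) := by
  rw [(circleModule T).coe_compression_apply (fourier_mem_analytic hm), coeff_rep_fourier]

theorem coeff_zero_shift (x : (circleModule T).posSpace) :
    coeff 0 ((circleModule T).compression (fourier 1) x : (circleModule T).H) = 0 :=
  (coeff_compression_fourier zero_le_one x 0).trans
    ((mem_posSpace_iff _).1 x.2 _ (by norm_num))

theorem backwardShift_shift (x : (circleModule T).posSpace) :
    (circleModule T).compression (fourier (-1)) ((circleModule T).compression (fourier 1) x) =
      x := by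
  have h := (circleModule T).compression_mul (fourier (-1)) (fourier_mem_analytic zero_le_one)
  rw [fourier_neg_one_mul_fourier_one, UnboundedModule.compression_one] at h
  exact (DFunLike.congr_fun h x).symm

/-- Multiplication by `fourier (-1)` leaves the Hardy space only through the zeroth coefficient,
which moves to frequency `-1`. If it vanishes, the projection removes nothing. -/
theorem shift_backwardShift {x : (circleModule T).posSpace}
    (hx : coeff 0 (x : (circleModule T).H) = 0) :
    (circleModule T).compression (fourier 1) ((circleModule T).compression (fourier (-1)) x) =
      x := by
  have hmem : (circleModule T).rep (fourier (-1)) x ∈ (circleModule T).posSpace := by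
    refine (mem_posSpace_iff _).2 fun k hk => ?_
    rw [coeff_rep_fourier]
    rcases eq_or_ne k (-1) with rfl | h
    · exact hx
    · exact (mem_posSpace_iff _).1 x.2 (k - -1) (by lia)
  have h1 : ((circleModule T).compression (fourier (-1)) x : (circleModule T).H) =
      (circleModule T).rep (fourier (-1)) x :=
    congrArg Subtype.val
      ((circleModule T).posSpace.orthogonalProjectionOnto_mem_subspace_eq_self ⟨_, hmem⟩)
  refine Subtype.ext (coeff_ext fun k => ?_)
  rw [coeff_compression_fourier zero_le_one, h1, coeff_rep_fourier]
  congr 2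
  ring

theorem exists_coeff_zero_ne : ∃ x : (circleModule T).posSpace,
    coeff 0 (x : (circleModule T).H) ≠ 0 :=
  ⟨⟨_, fourierLp_mem_posSpace le_rfl⟩, by
    have h : coeff 0 (show (circleModule T).H from fourierLp (T := T) 2 0) = 1 :=
      (coeffL_fourierLp 0 0).trans (if_pos rfl)
    rw [h]
    exact one_ne_zero⟩

end CircleModule

end

end Gasket

namespace Gasket

noncomputable section

/-! ### The index formula for polynomial matrix symbols. -/

section ToeplitzIndex

open AddCircle Polynomial

variable {T : ℝ} {n : ℕ}

theorem det_mul_apply (u v : Matrix (Fin n) (Fin n) C(AddCircle T, ℂ)) (x : AddCircle T) :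
    (u * v).det x = u.det x * v.det x := by
  rw [Matrix.det_mul, ContinuousMap.mul_apply]

/-- Evaluation of polynomials at the coordinate function of the unit circle. -/
def evalCircle : ℂ[X] →ₐ[ℂ] C(AddCircle T, ℂ) :=
  aeval (fourier 1)

theorem evalCircle_C (c : ℂ) : (evalCircle (C c) : C(AddCircle T, ℂ)) = .const _ c := by
  rw [evalCircle, aeval_C]
  rfl

theorem evalCircle_X_sub_C (a : ℂ) :
    (evalCircle (X - C a) : C(AddCircle T, ℂ)) = fourier 1 - .const _ a := by
  rw [map_sub, evalCircle_C, evalCircle, aeval_X]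

/-- Evaluation of polynomial matrices. -/
abbrev evalMatrix (P : Matrix (Fin n) (Fin n) ℂ[X]) : Matrix (Fin n) (Fin n) C(AddCircle T, ℂ) :=
  evalCircle.mapMatrix P

theorem det_evalMatrix (P : Matrix (Fin n) (Fin n) ℂ[X]) :
    (evalMatrix P).det = (evalCircle P.det : C(AddCircle T, ℂ)) :=
  (AlgHom.map_det _ _).symm

/-- The diagonal matrix with the entry `f` in the place `i`, and `1` in the other places. -/
def diagAt {A : Type*} [CommRing A] (i : Fin n) (f : A) : Matrix (Fin n) (Fin n) A :=
  Matrix.diagonal (Function.update 1 i f)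

theorem det_diagAt {A : Type*} [CommRing A] (i : Fin n) (f : A) : (diagAt i f).det = f := by
  rw [diagAt, Matrix.det_diagonal, Finset.prod_update_of_mem (Finset.mem_univ i)]
  simp

theorem diagAt_mul {A : Type*} [CommRing A] (i : Fin n) (f g : A) :
    diagAt i (f * g) = diagAt i f * diagAt i g := by
  rw [diagAt, diagAt, diagAt, Matrix.diagonal_mul_diagonal]
  congr 1
  funext j
  by_cases h : j = i
  · subst h; simp
  · simp [h]

variable [hT : Fact (0 < T)]

/-- The determinant of `u` has no zeros, the compression of `u` is Fredholm, and its index is the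
negative of the winding number of the determinant. -/
structure IndexFormula (u : Matrix (Fin n) (Fin n) C(AddCircle T, ℂ)) : Prop where
  det_ne_zero : ∀ x, u.det x ≠ 0
  isFredholm : ((circleModule T).matrixCompression u).IsFredholm
  index_eq : fredholmIndex ((circleModule T).matrixCompression u) = -windingNumber u.det

theorem IndexFormula.mul {u v : Matrix (Fin n) (Fin n) C(AddCircle T, ℂ)} (hu : IndexFormula u)
    (hv : IndexFormula v) (ha : ∀ i j, v i j ∈ (circleModule T).analytic) :
    IndexFormula (u * v) := by
  have e := (circleModule T).matrixCompression_mul u ha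
  refine ⟨fun x => ?_, ?_, ?_⟩
  · rw [det_mul_apply]
    exact mul_ne_zero (hu.det_ne_zero x) (hv.det_ne_zero x)
  · rw [e]
    exact isFredholm_comp hu.isFredholm hv.isFredholm
  · rw [e, Matrix.det_mul, windingNumber_mul hu.det_ne_zero hv.det_ne_zero, neg_add, ← hu.index_eq,
      ← hv.index_eq]
    exact fredholmIndex_comp hu.isFredholm hv.isFredholm

theorem IndexFormula.of_mul_right {u v : Matrix (Fin n) (Fin n) C(AddCircle T, ℂ)}
    (huv : IndexFormula (u * v)) (hv : IndexFormula v)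
    (ha : ∀ i j, v i j ∈ (circleModule T).analytic) : IndexFormula u := by
  have e := (circleModule T).matrixCompression_mul u ha
  have hu : ∀ x, u.det x ≠ 0 := fun x h => huv.det_ne_zero x (by rw [det_mul_apply, h, zero_mul])
  have h1 := huv.isFredholm
  have h2 := huv.index_eq
  rw [e] at h1 h2
  have h3 := isFredholm_of_comp_left hv.isFredholm h1
  refine ⟨hu, h3, ?_⟩
  have h4 := fredholmIndex_comp h3 hv.isFredholm
  rw [Matrix.det_mul, windingNumber_mul hu hv.det_ne_zero] at h2
  have h5 := hv.index_eq
  have h6 := h4.symm.trans h2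
  omega

theorem evalCircle_mem_analytic (p : ℂ[X]) :
    (evalCircle p : C(AddCircle T, ℂ)) ∈ (circleModule T).analytic := by
  have h : Algebra.adjoin ℂ {(fourier 1 : C(AddCircle T, ℂ))} ≤ (circleModule T).analytic :=
    Algebra.adjoin_le (Set.singleton_subset_iff.2 (fourier_mem_analytic zero_le_one))
  exact h (aeval_mem_adjoin_singleton ℂ _)

theorem evalMatrix_mem_analytic (P : Matrix (Fin n) (Fin n) ℂ[X]) (i j : Fin n) :
    (evalMatrix P i j : C(AddCircle T, ℂ)) ∈ (circleModule T).analytic :=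
  evalCircle_mem_analytic _

theorem indexFormula_of_isUnit {u : Matrix (Fin n) (Fin n) C(AddCircle T, ℂ)}
    (h0 : ∀ x, u.det x ≠ 0) (hw : windingNumber u.det = 0)
    (hu : IsUnit ((circleModule T).matrixCompression u)) : IndexFormula u :=
  ⟨h0, isFredholm_of_isUnit hu, by rw [fredholmIndex_of_isUnit hu, hw, neg_zero]⟩

/-- The determinant is a nonzero constant, so the inverse matrix is again polynomial, hence
analytic, and its compression inverts that of `P`. -/
theorem indexFormula_evalMatrix_of_isUnit {P : Matrix (Fin n) (Fin n) ℂ[X]} (hP : IsUnit P.det) :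
    IndexFormula (evalMatrix (T := T) P) := by
  obtain ⟨c, hc, hcP⟩ := Polynomial.isUnit_iff.1 hP
  have hdet : (evalMatrix P).det = ContinuousMap.const (AddCircle T) c := by
    rw [det_evalMatrix, ← hcP, evalCircle_C]
  refine indexFormula_of_isUnit (fun x => ?_) ?_ ?_
  · rw [hdet]
    exact hc.ne_zero
  · rw [hdet, windingNumber_const]
  · obtain ⟨v, rfl⟩ := (Matrix.isUnit_iff_isUnit_det P).2 hP
    refine ⟨⟨_, (circleModule T).matrixCompression (evalMatrix v.inv), ?_, ?_⟩, rfl⟩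
    · change (circleModule T).matrixCompression (evalMatrix v.val) * _ = 1
      rw [← UnboundedModule.matrixCompression_mul _ _ (evalMatrix_mem_analytic _), ← map_mul,
        v.val_inv, map_one, UnboundedModule.matrixCompression_one]
    · change _ * (circleModule T).matrixCompression (evalMatrix v.val) = 1
      rw [← UnboundedModule.matrixCompression_mul _ _ (evalMatrix_mem_analytic _), ← map_mul,
        v.inv_val, map_one, UnboundedModule.matrixCompression_one]

theorem diagAt_mem_analytic (i : Fin n) {f : C(AddCircle T, ℂ)}
    (hf : f ∈ (circleModule T).analytic) (j k : Fin n) :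
    diagAt i f j k ∈ (circleModule T).analytic := by
  rw [diagAt, Matrix.diagonal_apply]
  split_ifs with h
  · by_cases h' : j = i
    · subst h'; simpa using hf
    · simp [h', (circleModule T).analytic.one_mem]
  · exact (circleModule T).analytic.zero_mem

theorem isUnit_matrixCompression_diagAt (i : Fin n) {f : C(AddCircle T, ℂ)}
    (hf : IsUnit ((circleModule T).compression f)) :
    IsUnit ((circleModule T).matrixCompression (diagAt i f)) := by
  refine UnboundedModule.isUnit_matrixCompression_diagonal _ fun j => ?_
  by_cases h : j = i
  · subst h; simpa using hf
  · simp [h, UnboundedModule.compression_one]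

theorem norm_smul_fourier_lt {a : ℂ} (ha : ‖a‖ < 1) (m : ℤ) :
    ‖a • (fourier m : C(AddCircle T, ℂ))‖ < 1 := by
  rwa [norm_smul, fourier_norm, mul_one]

theorem matrixCompression_diagAt_apply_self (i : Fin n) (f : C(AddCircle T, ℂ))
    (x : Fin n → (circleModule T).posSpace) :
    (circleModule T).matrixCompression (diagAt i f) x i = (circleModule T).compression f (x i) := by
  rw [diagAt, UnboundedModule.matrixCompression_diagonal_apply, Function.update_self]

theorem matrixCompression_diagAt_apply_ne {i j : Fin n} (h : j ≠ i) (f : C(AddCircle T, ℂ))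
    (x : Fin n → (circleModule T).posSpace) :
    (circleModule T).matrixCompression (diagAt i f) x j = x j := by
  rw [diagAt, UnboundedModule.matrixCompression_diagonal_apply, Function.update_of_ne h,
    Pi.one_apply, UnboundedModule.compression_one]
  rfl

/-- The compression is the unilateral shift in slot `i` and the identity elsewhere. The backward
shift is a left inverse, and the range is the hyperplane where the zeroth coefficient of component
`i` vanishes. -/
theorem indexFormula_diagAt_fourier_one (i : Fin n) :
    IndexFormula (diagAt i (fourier 1 : C(AddCircle T, ℂ))) := by
  have h := isFredholm_of_range_eq_ker
    (S := (circleModule T).matrixCompression (diagAt i (fourier 1)))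
    (L := (circleModule T).matrixCompression (diagAt i (fourier (-1))))
    (φ := (coeff 0).toLinearMap ∘ₗ (circleModule T).posSpace.subtype ∘ₗ LinearMap.proj i)
    (fun x => ?_) (fun x => ?_) (fun y hy => ?_) ?_
  · refine ⟨fun x => ?_, h.1, ?_⟩
    · rw [det_diagAt, ← norm_pos_iff, norm_fourier_apply]
      exact one_pos
    · rw [det_diagAt, windingNumber_fourier_one]
      exact h.2
  · funext j
    by_cases hj : j = i
    · subst hj
      rw [matrixCompression_diagAt_apply_self, matrixCompression_diagAt_apply_self,
        backwardShift_shift]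
    · rw [matrixCompression_diagAt_apply_ne hj, matrixCompression_diagAt_apply_ne hj]
  · change coeff 0 (((circleModule T).matrixCompression (diagAt i (fourier 1)) x i :
      (circleModule T).posSpace) : (circleModule T).H) = 0
    rw [matrixCompression_diagAt_apply_self, coeff_zero_shift]
  · funext j
    by_cases hj : j = i
    · subst hj
      rw [matrixCompression_diagAt_apply_self, matrixCompression_diagAt_apply_self,
        shift_backwardShift (x := y j) hy]
    · rw [matrixCompression_diagAt_apply_ne hj, matrixCompression_diagAt_apply_ne hj]
  · obtain ⟨x, hx⟩ := exists_coeff_zero_ne (T := T)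
    exact ⟨fun _ => x, hx⟩

theorem indexFormula_diagAt_sub {a : ℂ} (ha : ‖a‖ ≠ 1) (i : Fin n) :
    IndexFormula (diagAt i (fourier 1 - ContinuousMap.const (AddCircle T) a)) := by
  have h0 := fun x => fourier_one_sub_ne_zero (T := T) ha x
  have hw := windingNumber_fourier_one_sub (T := T) ha
  rcases lt_or_gt_of_ne ha with h | h
  -- For `‖a‖ < 1`, `z - a = (1 - a z⁻¹) z`. The non-analytic factor stands on the left, where it is
  -- allowed, and its compression is invertible.
  · have e : fourier 1 - ContinuousMap.const (AddCircle T) a =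
        (1 - a • fourier (-1)) * fourier 1 := by
      rw [sub_mul, one_mul, smul_mul_assoc, fourier_neg_one_mul_fourier_one]
      ext x
      simp
    have h1 : ∀ x, (1 - a • fourier (-1) : C(AddCircle T, ℂ)) x ≠ 0 := fun x hx => by
      refine h0 x ?_
      have := DFunLike.congr_fun e x
      rw [ContinuousMap.mul_apply, hx, zero_mul] at this
      exact this
    rw [e, diagAt_mul]
    refine IndexFormula.mul (indexFormula_of_isUnit ?_ ?_
      (isUnit_matrixCompression_diagAt i
        ((circleModule T).isUnit_compression_one_sub (norm_smul_fourier_lt h _))))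
      (indexFormula_diagAt_fourier_one i) (diagAt_mem_analytic i (fourier_mem_analytic zero_le_one))
    · rwa [det_diagAt]
    · rw [det_diagAt]
      refine windingNumber_eq_zero_of_norm_lt fun x => ?_
      rw [ContinuousMap.sub_apply, ContinuousMap.one_apply, sub_sub_cancel_left, norm_neg,
        ContinuousMap.smul_apply, norm_smul, norm_fourier_apply, mul_one]
      exact h
  -- For `‖a‖ > 1`, `z - a = -a (1 - a⁻¹ z)` has an invertible compression.
  · have ha0 : a ≠ 0 := norm_pos_iff.1 (one_pos.trans h)
    refine indexFormula_of_isUnit (by rwa [det_diagAt]) (by rw [det_diagAt, hw, if_neg h.not_gt]) ?_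
    refine isUnit_matrixCompression_diagAt i ?_
    have e : fourier 1 - ContinuousMap.const (AddCircle T) a =
        (-a) • (1 - a⁻¹ • fourier 1) := by
      ext x
      simp only [ContinuousMap.sub_apply, ContinuousMap.smul_apply, ContinuousMap.const_apply,
        ContinuousMap.one_apply, smul_eq_mul]
      field_simp
      ring
    rw [e, UnboundedModule.compression_smul]
    have h1 : ‖a⁻¹‖ < 1 := by rw [norm_inv]; exact inv_lt_one_of_one_lt₀ h
    rw [Algebra.smul_def (-a) ((circleModule T).compression _)]
    refine IsUnit.mul ?_ ((circleModule T).isUnit_compression_one_sub (norm_smul_fourier_lt h1 1))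
    exact (Ne.isUnit (neg_ne_zero.2 ha0)).map _

theorem exists_fourier_one_eq {a : ℂ} (ha : ‖a‖ = 1) : ∃ x : AddCircle T, fourier 1 x = a := by
  obtain ⟨x, hx⟩ := (AddCircle.homeomorphCircle hT.out.ne').surjective
    ⟨a, mem_sphere_zero_iff_norm.2 ha⟩
  refine ⟨x, ?_⟩
  rw [fourier_one, ← AddCircle.homeomorphCircle_apply hT.out.ne', hx]

/-- A polynomial matrix whose determinant has the root `a` has a factor `diag(X - a, 1, …, 1)`. -/
theorem exists_factor_of_isRoot {P : Matrix (Fin n) (Fin n) ℂ[X]} {a : ℂ} (ha : P.det.IsRoot a) :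
    ∃ (Q R : Matrix (Fin n) (Fin n) ℂ[X]) (i : Fin n),
      P = Q * diagAt i (X - C a) * R ∧ IsUnit R.det := by
  obtain ⟨v, hv0, hv⟩ := Matrix.exists_mulVec_eq_zero_iff.2
    (show ((evalRingHom a).mapMatrix P).det = 0 by rw [← RingHom.map_det]; exact ha)
  obtain ⟨i, hi⟩ := Function.ne_iff.1 hv0
  have hi' : v i ≠ 0 := hi
  -- `S` is a constant matrix with determinant `v i ≠ 0`. Column `i` of `P S` is `P v`, which
  -- vanishes at `a` because `v` is in the kernel of `P(a)`; hence `X - a` can be taken out of that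
  -- column.
  let S : Matrix (Fin n) (Fin n) ℂ := Matrix.updateCol 1 i v
  have hS : IsUnit S.det := by
    have : S.det = v i := by
      rw [← Matrix.cramer_apply, Matrix.cramer_one]
      rfl
    rw [this]
    exact hi'.isUnit
  have hdvd : ∀ j, X - C a ∣ (P * (C : ℂ →+* ℂ[X]).mapMatrix S) j i := by
    intro j
    rw [dvd_iff_isRoot, IsRoot, Matrix.mul_apply, eval_finsetSum]
    refine Eq.trans ?_ (congrFun hv j)
    refine Finset.sum_congr rfl fun k _ => ?_
    simp [S]
  choose q hq using hdvd
  refine ⟨Matrix.updateCol (P * (C : ℂ →+* ℂ[X]).mapMatrix S) i q, C.mapMatrix S⁻¹, i, ?_, ?_⟩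
  · have h1 : Matrix.updateCol (P * (C : ℂ →+* ℂ[X]).mapMatrix S) i q * diagAt i (X - C a) =
        P * (C : ℂ →+* ℂ[X]).mapMatrix S := by
      ext1 j k
      rw [diagAt, Matrix.mul_diagonal]
      by_cases hk : k = i
      · subst hk
        rw [Matrix.updateCol_self, Function.update_self, hq, mul_comm]
      · rw [Matrix.updateCol_ne hk, Function.update_of_ne hk, Pi.one_apply, mul_one]
    rw [h1, mul_assoc, ← map_mul, Matrix.mul_nonsing_inv _ hS, map_one, mul_one]
  · rw [← RingHom.map_det]
    exact (Matrix.isUnit_nonsing_inv_det _ hS).map _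

/-- Induction on the degree of the determinant: splitting off a root lowers it by one, and every
factor is polynomial, so the index formula is multiplicative. The induction ends with a unit
determinant. -/
theorem indexFormula_evalMatrix {P : Matrix (Fin n) (Fin n) ℂ[X]}
    (hP : ∀ x : AddCircle T, evalCircle P.det x ≠ 0) : IndexFormula (evalMatrix (T := T) P) := by
  induction hd : P.det.natDegree using Nat.strong_induction_on generalizing P with
  | _ d ih =>
    have hP0 : P.det ≠ 0 := fun h => hP 0 (by rw [h, map_zero evalCircle]; rfl)
    by_cases hu : IsUnit P.det
    · exact indexFormula_evalMatrix_of_isUnit hu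
    · obtain ⟨a, ha⟩ := IsAlgClosed.exists_root P.det
        (fun h => hu (Polynomial.isUnit_iff_degree_eq_zero.2 h))
      obtain ⟨Q, R, i, hPQ, hR⟩ := exists_factor_of_isRoot ha
      have hdet : P.det = Q.det * (X - C a) * R.det := by
        rw [hPQ, Matrix.det_mul, Matrix.det_mul, det_diagAt]
      have hx : ∀ x : AddCircle T, evalCircle Q.det x ≠ 0 ∧ fourier 1 x - a ≠ 0 := by
        intro x
        have h := hP x
        rw [hdet, map_mul, map_mul, evalCircle_X_sub_C] at h
        exact ⟨left_ne_zero_of_mul (left_ne_zero_of_mul h),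
          right_ne_zero_of_mul (left_ne_zero_of_mul h)⟩
      -- A root on the unit circle would be a zero of the determinant of the symbol.
      have hna : ‖a‖ ≠ 1 := fun h => by
        obtain ⟨x, hxa⟩ := exists_fourier_one_eq (T := T) h
        exact (hx x).2 (sub_eq_zero.2 hxa)
      have hQ0 : Q.det ≠ 0 := by
        rintro h
        exact hP0 (by rw [hdet, h, zero_mul, zero_mul])
      have hlt : Q.det.natDegree < d := by
        rw [← hd, hdet, natDegree_mul (mul_ne_zero hQ0 (X_sub_C_ne_zero a)) hR.ne_zero,
          natDegree_mul hQ0 (X_sub_C_ne_zero a), natDegree_X_sub_C]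
        omega
      have hD : evalMatrix (T := T) (diagAt i (X - C a)) = diagAt i (fourier 1 - .const _ a) := by
        rw [← evalCircle_X_sub_C]
        ext1 j k
        simp only [evalMatrix, AlgHom.mapMatrix_apply, Matrix.map_apply, diagAt,
          Matrix.diagonal_apply]
        split_ifs
        · by_cases h : j = i
          · subst h; simp
          · simp [h]
        · exact map_zero _
      rw [hPQ, evalMatrix, map_mul, map_mul]
      refine ((ih _ hlt (fun x => (hx x).1) rfl).mul ?_ (evalMatrix_mem_analytic _)).mul
        (indexFormula_evalMatrix_of_isUnit hR) (evalMatrix_mem_analytic _)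
      rw [hD]
      exact indexFormula_diagAt_sub hna i

end ToeplitzIndex

end

end Gasket

namespace Gasket

noncomputable section

/-! ### The index formula for continuous unitary symbols. -/

section UnitaryIndex

open AddCircle Polynomial Filter Topology

theorem evalCircle_X_pow {T : ℝ} (k : ℕ) :
    (evalCircle (X ^ k) : C(AddCircle T, ℂ)) = fourier k := by
  ext x
  rw [map_pow, evalCircle, aeval_X, ContinuousMap.pow_apply]
  simp only [fourier_apply, one_zsmul, natCast_zsmul, AddCircle.toCircle_nsmul]
  push_cast
  rfl

/-- A large power of the coordinate clears all negative frequencies. The form "for all large `N`"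
yields one `N` that serves all entries of a matrix. -/
theorem eventually_exists_evalCircle_eq {T : ℝ} {f : C(AddCircle T, ℂ)}
    (hf : f ∈ Submodule.span ℂ (Set.range (fourier (T := T)))) :
    ∀ᶠ N : ℕ in atTop, ∃ p : ℂ[X], evalCircle p = f * fourier N := by
  induction hf using Submodule.span_induction with
  | mem x hx =>
    obtain ⟨k, rfl⟩ := hx
    filter_upwards [eventually_ge_atTop k.natAbs] with N hN
    refine ⟨X ^ (k + N).toNat, ?_⟩
    have h : ((k + N).toNat : ℤ) = k + N := Int.toNat_of_nonneg (by omega)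
    rw [evalCircle_X_pow, h]
    ext x
    rw [ContinuousMap.mul_apply, ← fourier_add]
  | zero => exact Eventually.of_forall fun N => ⟨0, by rw [map_zero, zero_mul]⟩
  | add f g _ _ hf hg =>
    filter_upwards [hf, hg] with N ⟨p, hp⟩ ⟨q, hq⟩
    exact ⟨p + q, by rw [map_add, hp, hq, add_mul]⟩
  | smul c f _ hf =>
    filter_upwards [hf] with N ⟨p, hp⟩
    exact ⟨c • p, by rw [map_smul, hp, smul_mul_assoc]⟩

variable {T : ℝ} [hT : Fact (0 < T)] {n : ℕ}

theorem dense_trigonometric_matrices :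
    Dense {V : Matrix (Fin n) (Fin n) C(AddCircle T, ℂ) |
      ∀ i j, V i j ∈ Submodule.span ℂ (Set.range (fourier (T := T)))} := by
  have h : Dense ((Submodule.span ℂ (Set.range (fourier (T := T))) :
      Submodule ℂ C(AddCircle T, ℂ)) : Set C(AddCircle T, ℂ)) :=
    Submodule.dense_iff_topologicalClosure_eq_top.2 span_fourier_closure_eq_top
  have h2 := dense_pi (Set.univ : Set (Fin n)) fun i _ =>
    dense_pi (Set.univ : Set (Fin n)) fun j _ => h
  have hsub : (Set.univ.pi fun _ : Fin n => Set.univ.pi fun _ : Fin n =>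
      ((Submodule.span ℂ (Set.range (fourier (T := T))) : Submodule ℂ C(AddCircle T, ℂ)) :
        Set C(AddCircle T, ℂ))) ⊆ {V | ∀ i j, V i j ∈ Submodule.span ℂ (Set.range fourier)} :=
    fun V hV i j => hV i trivial j trivial
  exact Dense.mono hsub h2

/-- Through the adjugate this reduces to inversion in the Banach algebra of continuous functions,
which is continuous at units. -/
theorem continuousAt_matrix_inv_one :
    ContinuousAt (fun A : Matrix (Fin n) (Fin n) C(AddCircle T, ℂ) => A⁻¹) 1 := by
  have h1 : ContinuousAt (fun A : Matrix (Fin n) (Fin n) C(AddCircle T, ℂ) =>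
      Ring.inverse A.det) 1 := by
    have h2 := NormedRing.inverse_continuousAt (1 : C(AddCircle T, ℂ)ˣ)
    refine ContinuousAt.comp (g := Ring.inverse) ?_ continuous_id.matrix_det.continuousAt
    simpa using h2
  simp only [Matrix.inv_def]
  exact h1.smul continuous_id.matrix_adjugate.continuousAt

/-- The index of the Toeplitz operator with a unitary matrix symbol. -/
theorem indexFormula_of_unitary (U : Matrix.unitaryGroup (Fin n) C(AddCircle T, ℂ)) :
    IndexFormula U.1 := by
  -- A symbol close to `1` has an invertible compression, since the invertible operators form an
  -- open set, and a determinant that does not wind.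
  have hW : ∀ᶠ W : Matrix (Fin n) (Fin n) C(AddCircle T, ℂ) in 𝓝 1,
      IsUnit ((circleModule T).matrixCompression W) ∧ ‖W.det - 1‖ < 1 := by
    refine Eventually.and ?_ ?_
    · have h1 := ((circleModule T).continuous_matrixCompression (n := n)).tendsto' 1 1
        (circleModule T).matrixCompression_one
      have h2 := Units.isOpen (R := (Fin n → (circleModule T).posSpace) →L[ℂ]
        (Fin n → (circleModule T).posSpace))
      exact h1.eventually (h2.eventually_mem isUnit_one)
    · have hc : Continuous fun W : Matrix (Fin n) (Fin n) C(AddCircle T, ℂ) => ‖W.det - 1‖ :=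
        (continuous_id.matrix_det.sub continuous_const).norm
      refine hc.continuousAt.eventually (gt_mem_nhds ?_)
      simp
  have hA : ∀ᶠ A : Matrix (Fin n) (Fin n) C(AddCircle T, ℂ) in 𝓝 1, IsUnit A.det ∧
      IsUnit ((circleModule T).matrixCompression A⁻¹) ∧ ‖A⁻¹.det - 1‖ < 1 := by
    refine Eventually.and ?_ (continuousAt_matrix_inv_one.eventually (p := fun W =>
      IsUnit ((circleModule T).matrixCompression W) ∧ ‖W.det - 1‖ < 1) ?_)
    · have hc : Continuous fun A : Matrix (Fin n) (Fin n) C(AddCircle T, ℂ) => A.det :=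
        continuous_id.matrix_det
      exact (hc.tendsto' 1 1 Matrix.det_one).eventually (Units.isOpen.eventually_mem isUnit_one)
    · simpa only [inv_one] using hW
  have hV : ∀ᶠ V : Matrix (Fin n) (Fin n) C(AddCircle T, ℂ) in 𝓝 U.1, IsUnit (V * star U.1).det ∧
      IsUnit ((circleModule T).matrixCompression (V * star U.1)⁻¹) ∧
        ‖(V * star U.1)⁻¹.det - 1‖ < 1 := by
    have hc : Continuous fun V : Matrix (Fin n) (Fin n) C(AddCircle T, ℂ) => V * star U.1 :=
      continuous_id.mul continuous_const
    exact (hc.tendsto' U.1 1 (Matrix.mem_unitaryGroup_iff.1 U.2)).eventually hA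
  obtain ⟨V, hVs, hu, hτ, hd⟩ := dense_trigonometric_matrices.inter_nhds_nonempty hV
  -- The approximation error is put into a left factor `W`, which need not be analytic.
  have hWV : (V * star U.1)⁻¹ * V = U.1 := by
    have h := Matrix.nonsing_inv_mul _ hu
    rw [← mul_assoc] at h
    have h1 := congrArg (· * U.1) h
    simpa only [mul_assoc, Matrix.mem_unitaryGroup_iff'.1 U.2, mul_one, one_mul] using h1
  set W := (V * star U.1)⁻¹
  have hWx : ∀ x, ‖W.det x - 1‖ < 1 := fun x => ((W.det - 1).norm_coe_le_norm x).trans_lt hd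
  have hWi : IndexFormula W := by
    refine indexFormula_of_isUnit (fun x h => ?_) (windingNumber_eq_zero_of_norm_lt hWx) hτ
    have := hWx x
    rw [h] at this
    simp at this
  obtain ⟨N, hN⟩ := (eventually_all.2 fun i => eventually_all.2 fun j =>
    eventually_exists_evalCircle_eq (hVs i j)).exists
  choose p hp using hN
  have hZe : (evalMatrix (T := T) (Matrix.diagonal fun _ : Fin n => (X ^ N : ℂ[X]))) =
      Matrix.diagonal fun _ => (fourier N : C(AddCircle T, ℂ)) := by
    rw [evalMatrix, AlgHom.mapMatrix_apply, Matrix.diagonal_map (map_zero _)]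
    simp only [evalCircle_X_pow]
  have hVP : V * evalMatrix (Matrix.diagonal fun _ : Fin n => (X ^ N : ℂ[X])) =
      evalMatrix (Matrix.of p) := by
    rw [hZe]
    ext1 i j
    rw [Matrix.mul_diagonal]
    exact (hp i j).symm
  have hZ0 : ∀ x : AddCircle T,
      evalCircle (Matrix.diagonal fun _ : Fin n => (X ^ N : ℂ[X])).det x ≠ 0 := by
    intro x
    rw [← det_evalMatrix, hZe, Matrix.det_diagonal, Finset.prod_const, ContinuousMap.pow_apply,
      ← norm_pos_iff, norm_pow, norm_fourier_apply, one_pow]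
    exact one_pos
  have hZ := indexFormula_evalMatrix hZ0
  -- `V` alone need not be analytic, so the formula is proved for `U zᴺ = W (V zᴺ)`, and the
  -- analytic factor `zᴺ` is then cancelled.
  refine IndexFormula.of_mul_right ?_ hZ (evalMatrix_mem_analytic _)
  rw [← hWV, mul_assoc, hVP]
  refine hWi.mul (indexFormula_evalMatrix fun x h => ?_) (evalMatrix_mem_analytic _)
  rw [← det_evalMatrix, ← hVP, det_mul_apply, det_evalMatrix] at h
  refine (mul_ne_zero ?_ (hZ0 x)) h
  intro hV0
  refine det_unitary_apply_ne_zero U x ?_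
  rw [← hWV, det_mul_apply, hV0, mul_zero]

theorem isIndexMap_windingHom {X : Type} [TopologicalSpace X] [LocallyCompactSpace X]
    (γ : C(AddCircle T, X)) : IsIndexMap (loopModule γ) (windingHom γ) := by
  intro n u
  let φ : C(X, ℂ) →⋆ₐ[ℂ] C(AddCircle T, ℂ) := ContinuousMap.compStarAlgHom' ℂ ℂ γ
  have hU : u.1.map φ ∈ Matrix.unitaryGroup (Fin n) C(AddCircle T, ℂ) := by
    have h := congrArg (φ : C(X, ℂ) →+* C(AddCircle T, ℂ)).mapMatrix
      (Matrix.mem_unitaryGroup_iff.1 u.2)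
    rw [map_mul, map_one] at h
    rw [Matrix.mem_unitaryGroup_iff, ← h]
    congr 1
  have h := indexFormula_of_unitary ⟨_, hU⟩
  rw [matrixCompression_loopModule]
  refine ⟨h.isFredholm, ?_⟩
  have hdet : u.1.det.comp γ = (u.1.map φ).det :=
    RingHom.map_det (φ : C(X, ℂ) →+* C(AddCircle T, ℂ)) u.1
  rw [windingHom_mk, hdet]
  have := h.index_eq
  exact (neg_eq_iff_eq_neg.2 this).symm

end UnitaryIndex

end

end Gasket

namespace Gasket

noncomputable section

/-! ### Increments of logarithms along segments. -/

section Segments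

open Set

/-- A continuous logarithm of `F` along the segment from `p` to `q` changes by `δ`. -/
def HasSegmentIncrement (F : ℂ → ℂ) (p q δ : ℂ) : Prop :=
  ∃ L : ℝ → ℂ, ContinuousOn L (Icc 0 1) ∧
    (∀ t ∈ Icc (0 : ℝ) 1, Complex.exp (L t) = F (p + t * (q - p))) ∧ L 1 - L 0 = δ

/-- Two logarithms differ by a continuous function with values in `2πiℤ`, which is constant on the
interval. So the increment depends on the side alone and not on the triangle it is taken from. -/
theorem HasSegmentIncrement.unique {F : ℂ → ℂ} {p q δ ε : ℂ} (hδ : HasSegmentIncrement F p q δ)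
    (hε : HasSegmentIncrement F p q ε) : δ = ε := by
  obtain ⟨L, hLc, hL, rfl⟩ := hδ
  obtain ⟨M, hMc, hM, rfl⟩ := hε
  have key : ∀ t ∈ Icc (0 : ℝ) 1, ∃ n : ℤ, L t - M t = n * (2 * Real.pi * Complex.I) := by
    intro t ht
    obtain ⟨n, hn⟩ := Complex.exp_eq_exp_iff_exists_int.1 ((hL t ht).trans (hM t ht).symm)
    exact ⟨n, by rw [hn]; ring⟩
  have h2 : (2 * Real.pi * Complex.I : ℂ) ≠ 0 := Complex.two_pi_I_ne_zero
  have hmap : MapsTo (fun t => ((L t - M t) / (2 * Real.pi * Complex.I)).re) (Icc 0 1)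
      (range ((↑) : ℤ → ℝ)) := by
    intro t ht
    obtain ⟨n, hn⟩ := key t ht
    exact ⟨n, by simp only [hn, mul_div_cancel_right₀ _ h2, Complex.intCast_re]⟩
  have hcont : ContinuousOn (fun t => ((L t - M t) / (2 * Real.pi * Complex.I)).re)
      (Icc (0 : ℝ) 1) :=
    Complex.continuous_re.comp_continuousOn ((hLc.sub hMc).div_const _)
  have hdisc : IsDiscrete (range ((↑) : ℤ → ℝ)) :=
    Int.isClosedEmbedding_coe_real.isEmbedding.isDiscrete_range
  have h := isPreconnected_Icc.constant_of_mapsTo hdisc hcont hmap (left_mem_Icc.2 zero_le_one)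
    (right_mem_Icc.2 zero_le_one)
  obtain ⟨m, hm⟩ := key 0 (left_mem_Icc.2 zero_le_one)
  obtain ⟨n, hn⟩ := key 1 (right_mem_Icc.2 zero_le_one)
  simp only [hm, hn, mul_div_cancel_right₀ _ h2, Complex.intCast_re] at h
  have hmn : m = n := by exact_mod_cast h
  rw [hmn] at hm
  linear_combination hn - hm

theorem HasSegmentIncrement.reverse {F : ℂ → ℂ} {p q δ : ℂ} (h : HasSegmentIncrement F p q δ) :
    HasSegmentIncrement F q p (-δ) := by
  obtain ⟨L, hLc, hL, rfl⟩ := h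
  refine ⟨fun t => L (1 - t), hLc.comp (by fun_prop) fun t ht => ?_, fun t ht => ?_, by simp⟩
  · exact ⟨by linarith [ht.2], by linarith [ht.1]⟩
  · rw [hL (1 - t) ⟨by linarith [ht.2], by linarith [ht.1]⟩]
    congr 1
    push_cast
    ring

theorem HasSegmentIncrement.split {F : ℂ → ℂ} {p q δ : ℂ} (h : HasSegmentIncrement F p q δ) :
    ∃ δ₁ δ₂, HasSegmentIncrement F p ((p + q) / 2) δ₁ ∧
      HasSegmentIncrement F ((p + q) / 2) q δ₂ ∧ δ₁ + δ₂ = δ := by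
  obtain ⟨L, hLc, hL, rfl⟩ := h
  refine ⟨L (1 / 2) - L 0, L 1 - L (1 / 2),
    ⟨fun t => L (t / 2), hLc.comp (by fun_prop) fun t ht => ?_, fun t ht => ?_, by norm_num⟩,
    ⟨fun t => L ((1 + t) / 2), hLc.comp (by fun_prop) fun t ht => ?_, fun t ht => ?_, by norm_num⟩,
    by ring⟩
  · exact ⟨by linarith [ht.1], by linarith [ht.2]⟩
  · rw [hL (t / 2) ⟨by linarith [ht.1], by linarith [ht.2]⟩]
    congr 1
    push_cast
    ring
  · exact ⟨by linarith [ht.1], by linarith [ht.2]⟩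
  · rw [hL ((1 + t) / 2) ⟨by linarith [ht.1], by linarith [ht.2]⟩]
    congr 1
    push_cast
    ring

theorem trianglePath_first (a b c : ℂ) {s : ℝ} (hs : s ∈ Icc (0 : ℝ) 1) :
    trianglePath a b c (s / 3) = a + s * (b - a) := by
  have e1 : max 0 (min (3 * (s / 3)) 1) = s := by
    rw [mul_div_cancel₀ _ (by norm_num : (3 : ℝ) ≠ 0), min_eq_left hs.2, max_eq_right hs.1]
  have e2 : max 0 (min (3 * (s / 3) - 1) 1) = 0 :=
    max_eq_left ((min_le_left _ _).trans (by linarith [hs.2]))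
  have e3 : max 0 (min (3 * (s / 3) - 2) 1) = 0 :=
    max_eq_left ((min_le_left _ _).trans (by linarith [hs.2]))
  simp [trianglePath, e1, e2, e3]

theorem trianglePath_second (a b c : ℂ) {s : ℝ} (hs : s ∈ Icc (0 : ℝ) 1) :
    trianglePath a b c ((1 + s) / 3) = b + s * (c - b) := by
  have e1 : max 0 (min (3 * ((1 + s) / 3)) 1) = 1 := by
    rw [min_eq_right (by linarith [hs.1]), max_eq_right zero_le_one]
  have e2 : max 0 (min (3 * ((1 + s) / 3) - 1) 1) = s := by
    rw [mul_div_cancel₀ _ (by norm_num : (3 : ℝ) ≠ 0), add_sub_cancel_left, min_eq_left hs.2,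
      max_eq_right hs.1]
  have e3 : max 0 (min (3 * ((1 + s) / 3) - 2) 1) = 0 :=
    max_eq_left ((min_le_left _ _).trans (by linarith [hs.2]))
  simp [trianglePath, e1, e2, e3]

theorem trianglePath_third (a b c : ℂ) {s : ℝ} (hs : s ∈ Icc (0 : ℝ) 1) :
    trianglePath a b c ((2 + s) / 3) = c + s * (a - c) := by
  have e1 : max 0 (min (3 * ((2 + s) / 3)) 1) = 1 := by
    rw [min_eq_right (by linarith [hs.1]), max_eq_right zero_le_one]
  have e2 : max 0 (min (3 * ((2 + s) / 3) - 1) 1) = 1 := by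
    rw [min_eq_right (by linarith [hs.1]), max_eq_right zero_le_one]
  have e3 : max 0 (min (3 * ((2 + s) / 3) - 2) 1) = s := by
    rw [mul_div_cancel₀ _ (by norm_num : (3 : ℝ) ≠ 0), add_sub_cancel_left, min_eq_left hs.2,
      max_eq_right hs.1]
  simp [trianglePath, e1, e2, e3]

theorem triangleCurve_coe (T : ℝ) [hT : Fact (0 < T)] (a b c : ℂ) {s : ℝ}
    (hs : s ∈ Icc (0 : ℝ) 1) :
    triangleCurve T a b c ((T * s : ℝ) : AddCircle T) = trianglePath a b c s := by
  have h1 : ∀ t ∈ Ico (0 : ℝ) T, triangleCurve T a b c (t : AddCircle T) =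
      trianglePath a b c (t / T) := fun t ht =>
    AddCircle.liftIco_coe_apply (f := fun t => trianglePath a b c (t / T)) (by simpa using ht)
  have hT0 := hT.out
  rcases eq_or_lt_of_le hs.2 with rfl | h
  -- The parameter `T` lies outside the fundamental domain `[0, T)`: it is the point `0`, and the
  -- path closes up there.
  · have h3 := trianglePath_third a b c (s := 1) (right_mem_Icc.2 zero_le_one)
    have h0 := trianglePath_first a b c (s := 0) (left_mem_Icc.2 zero_le_one)
    rw [mul_one, AddCircle.coe_period, ← AddCircle.coe_zero, h1 0 ⟨le_rfl, hT0⟩, zero_div]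
    norm_num at h3 h0
    rw [h3, h0]
  · rw [h1 _ ⟨mul_nonneg hT0.le hs.1, by nlinarith⟩, mul_div_cancel_left₀ _ hT0.ne']

/-- The winding number along a triangle is the sum of the increments along the sides. -/
theorem exists_segmentIncrements {T : ℝ} [hT : Fact (0 < T)] {g : C(AddCircle T, ℂ)} {k : ℤ}
    (hg : HasWindingNumber g k) {F : ℂ → ℂ} {a b c : ℂ}
    (hF : ∀ x, g x = F (triangleCurve T a b c x)) :
    ∃ x y z, HasSegmentIncrement F a b x ∧ HasSegmentIncrement F b c y ∧
      HasSegmentIncrement F c a z ∧ x + y + z = 2 * Real.pi * Complex.I * k := by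
  obtain ⟨L, hL, hk⟩ := hg
  have key : ∀ s ∈ Icc (0 : ℝ) 1, Complex.exp (L (T * s)) = F (trianglePath a b c s) := by
    intro s hs
    rw [hL, hF, triangleCurve_coe T a b c hs]
  refine ⟨L (T * (1 / 3)) - L (T * 0), L (T * (2 / 3)) - L (T * (1 / 3)),
    L (T * 1) - L (T * (2 / 3)),
    ⟨fun s => L (T * (s / 3)), by fun_prop, fun s hs => ?_, by norm_num⟩,
    ⟨fun s => L (T * ((1 + s) / 3)), by fun_prop, fun s hs => ?_, by norm_num⟩,
    ⟨fun s => L (T * ((2 + s) / 3)), by fun_prop, fun s hs => ?_, by norm_num⟩, ?_⟩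
  · rw [key _ ⟨by linarith [hs.1], by linarith [hs.2]⟩, trianglePath_first _ _ _ hs]
  · rw [key _ ⟨by linarith [hs.1], by linarith [hs.2]⟩, trianglePath_second _ _ _ hs]
  · rw [key _ ⟨by linarith [hs.1], by linarith [hs.2]⟩, trianglePath_third _ _ _ hs]
  · rw [mul_one, mul_zero, ← hk]
    ring

end Segments

/-! ### Cells, their central holes and their subcells. -/

section Cells

/-- Each letter halves differences. The affine properties of `cellMap` are deduced from this
formula. -/
theorem cellMap_sub (w : HSG) (z z' : ℂ) :
    cellMap w z - cellMap w z' = (z - z') / 2 ^ w.length := by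
  induction w with
  | nil => simp [cellMap]
  | cons i w ih =>
    change shrink i (cellMap w z) - shrink i (cellMap w z') = _
    rw [shrink, shrink, ← sub_div, add_sub_add_right_eq_sub, ih, List.length_cons, pow_succ,
      div_div]

theorem cellMap_append (v w : HSG) (z : ℂ) : cellMap (v ++ w) z = cellMap v (cellMap w z) := by
  induction v with
  | nil => rfl
  | cons i v ih => exact congrArg (shrink i) ih

theorem cellMap_midpt (w : HSG) (i j : Fin 3) :
    cellMap w (midpt i j) = (cellMap w (corner i) + cellMap w (corner j)) / 2 := by
  have h1 := cellMap_sub w (midpt i j) (corner i)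
  have h2 := cellMap_sub w (midpt i j) (corner j)
  have h3 : (midpt i j - corner i) + (midpt i j - corner j) = 0 := by rw [midpt]; ring
  linear_combination h1 / 2 + h2 / 2 + h3 / 2 / 2 ^ w.length

theorem cellMap_trianglePath (w : HSG) (a b c : ℂ) (s : ℝ) :
    cellMap w (trianglePath a b c s) =
      trianglePath (cellMap w a) (cellMap w b) (cellMap w c) s := by
  have h := cellMap_sub w (trianglePath a b c s) a
  rw [sub_eq_iff_eq_add.1 h, trianglePath, trianglePath, cellMap_sub w b a, cellMap_sub w c b,
    cellMap_sub w a c]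
  simp only [Complex.real_smul]
  ring

theorem cellMap_triangleCurve (w : HSG) (T : ℝ) [hT : Fact (0 < T)] (a b c : ℂ) (x : AddCircle T) :
    cellMap w (triangleCurve T a b c x) =
      triangleCurve T (cellMap w a) (cellMap w b) (cellMap w c) x :=
  cellMap_trianglePath w a b c _

variable (f : C(gasket, ℂ))

open Classical in
/-- Extension of a function on the gasket by zero. -/
def extend (z : ℂ) : ℂ :=
  if h : z ∈ gasket then f ⟨z, h⟩ else 0

theorem extend_coe (z : gasket) : extend f z = f z :=
  dif_pos z.2

variable {f}

/-- The increments refer to `extend f` and to end points in the plane, so that a side shared by two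
triangles gives comparable data. -/
theorem exists_increments_deltaLoop (hf : ∀ z, f z ≠ 0) (w : HSG) :
    ∃ x y z,
    HasSegmentIncrement (extend f) (cellMap w (corner 0)) (cellMap w (corner 1)) x ∧
    HasSegmentIncrement (extend f) (cellMap w (corner 1)) (cellMap w (corner 2)) y ∧
    HasSegmentIncrement (extend f) (cellMap w (corner 2)) (cellMap w (corner 0)) z ∧
    x + y + z = 2 * Real.pi * Complex.I * deltaWinding w f := by
  refine exists_segmentIncrements
    (hasWindingNumber_windingNumber (g := f.comp (deltaLoop w)) fun x => hf _) fun x => ?_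
  rw [← cellMap_triangleCurve]
  exact (extend_coe f (deltaLoop w x)).symm

theorem exists_increments_nablaLoop (hf : ∀ z, f z ≠ 0) (w : HSG) :
    ∃ x y z,
    HasSegmentIncrement (extend f) (cellMap w (midpt 0 1)) (cellMap w (midpt 1 2)) x ∧
    HasSegmentIncrement (extend f) (cellMap w (midpt 1 2)) (cellMap w (midpt 2 0)) y ∧
    HasSegmentIncrement (extend f) (cellMap w (midpt 2 0)) (cellMap w (midpt 0 1)) z ∧
    x + y + z = 2 * Real.pi * Complex.I * nablaWinding w f := by
  refine exists_segmentIncrements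
    (hasWindingNumber_windingNumber (g := f.comp (nablaLoop w)) fun x => hf _) fun x => ?_
  rw [← cellMap_triangleCurve]
  exact (extend_coe f (nablaLoop w x)).symm

/-- The winding number around a cell is the sum of the winding numbers around its central hole and
around its three subcells. -/
theorem deltaWinding_eq_add_sum (hf : ∀ z, f z ≠ 0) (w : HSG) :
    deltaWinding w f = nablaWinding w f + ∑ i, deltaWinding (w ++ [i]) f := by
  -- The corners of the subcells are the corners of the cell and the midpoints of its sides, since
  -- `shrink i (corner j) = midpt i j`.
  have hs : ∀ i j, cellMap (w ++ [i]) (corner j) = cellMap w (midpt i j) := by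
    intro i j
    rw [cellMap_append, midpt, add_comm (corner i)]
    rfl
  have hc : ∀ i j, midpt i j = midpt j i := fun i j => by rw [midpt, midpt, add_comm]
  have hd : ∀ i, midpt i i = corner i := fun i => by rw [midpt]; ring
  obtain ⟨x, y, z, hx, hy, hz, hxyz⟩ := exists_increments_deltaLoop hf w
  obtain ⟨p, q, r, hp, hq, hr, hpqr⟩ := exists_increments_nablaLoop hf w
  obtain ⟨x₁, x₂, hx₁, hx₂, rfl⟩ := hx.split
  obtain ⟨y₁, y₂, hy₁, hy₂, rfl⟩ := hy.split
  obtain ⟨z₁, z₂, hz₁, hz₂, rfl⟩ := hz.split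
  rw [← cellMap_midpt] at hx₁ hx₂ hy₁ hy₂ hz₁ hz₂
  obtain ⟨a₀, b₀, c₀, ha₀, hb₀, hc₀, h₀⟩ := exists_increments_deltaLoop hf (w ++ [0])
  obtain ⟨a₁, b₁, c₁, ha₁, hb₁, hc₁, h₁⟩ := exists_increments_deltaLoop hf (w ++ [1])
  obtain ⟨a₂, b₂, c₂, ha₂, hb₂, hc₂, h₂⟩ := exists_increments_deltaLoop hf (w ++ [2])
  rw [hs, hs] at ha₀ hb₀ hc₀ ha₁ hb₁ hc₁ ha₂ hb₂ hc₂
  rw [hd] at ha₀ hc₀ ha₁ hb₁ hb₂ hc₂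
  rw [hc 0 2] at hb₀ hc₀
  rw [hc 1 0] at ha₁ hc₁
  rw [hc 2 1] at ha₂ hb₂
  -- Of the nine sides of the subcells, six are halves of the sides of the cell, and three are sides
  -- of the hole traversed backwards.
  have e1 := ha₀.unique hx₁
  have e2 := hb₀.unique hr.reverse
  have e3 := hc₀.unique hz₂
  have e4 := ha₁.unique hx₂
  have e5 := hb₁.unique hy₁
  have e6 := hc₁.unique hp.reverse
  have e7 := ha₂.unique hq.reverse
  have e8 := hb₂.unique hy₂
  have e9 := hc₂.unique hz₁
  have h2 : (2 * Real.pi * Complex.I : ℂ) ≠ 0 := Complex.two_pi_I_ne_zero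
  have : ((deltaWinding w f : ℤ) : ℂ) =
      ((nablaWinding w f + ∑ i, deltaWinding (w ++ [i]) f : ℤ) : ℂ) := by
    rw [Fin.sum_univ_three]
    push_cast
    apply mul_left_cancel₀ h2
    linear_combination hpqr + h₀ + h₁ + h₂ - hxyz - e1 - e2 - e3 - e4 - e5 - e6 - e7 - e8 - e9
  exact_mod_cast this

end Cells

end

end Gasket

namespace Gasket

noncomputable section

/-! ### Vanishing around small triangles, and summation over words. -/

section SmallCells

theorem triangleCurve_corner_mem (T : ℝ) [hT : Fact (0 < T)] (x : AddCircle T) :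
    triangleCurve T (corner 0) (corner 1) (corner 2) x ∈ gasket := by
  rcases triangleCurve_mem T (corner 0) (corner 1) (corner 2) x with (h | h) | h
  exacts [segment_corner_subset _ _ h, segment_corner_subset _ _ h, segment_corner_subset _ _ h]

theorem triangleCurve_midpt_mem (T : ℝ) [hT : Fact (0 < T)] (x : AddCircle T) :
    triangleCurve T (midpt 0 1) (midpt 1 2) (midpt 2 0) x ∈ gasket := by
  rcases triangleCurve_mem T (midpt 0 1) (midpt 1 2) (midpt 2 0) x with (h | h) | h
  exacts [segment_midpt_subset _ _ _ h, segment_midpt_subset _ _ _ h,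
    segment_midpt_subset _ _ _ h]

/-- Uniform continuity with the minimum of `‖f‖` as tolerance: along a short curve `f` is closer to
`f (γ 0)` than `f (γ 0)` is to `0`. -/
theorem exists_windingNumber_eq_zero {f : C(gasket, ℂ)} (hf : ∀ z, f z ≠ 0) :
    ∃ δ > 0, ∀ {T : ℝ} (γ : C(AddCircle T, gasket)), (∀ x, dist (γ x) (γ 0) < δ) →
      windingNumber (f.comp γ) = 0 := by
  have hne : (Set.univ : Set gasket).Nonempty :=
    ⟨⟨corner 0, segment_corner_subset 0 0 (left_mem_segment ℝ _ _)⟩, trivial⟩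
  obtain ⟨z₀, -, hz₀⟩ := isCompact_univ.exists_isMinOn hne f.continuous.norm.continuousOn
  obtain ⟨δ, hδ, h⟩ := Metric.uniformContinuous_iff.1
    (CompactSpace.uniformContinuous_of_continuous f.continuous) ‖f z₀‖ (norm_pos_iff.2 (hf z₀))
  refine ⟨δ, hδ, fun γ hγ => ?_⟩
  refine (windingNumber_eq_of_norm_lt (g := ContinuousMap.const _ (f (γ 0))) (fun x => hf _)
    fun x => ?_).trans (windingNumber_const _)
  rw [← dist_eq_norm]
  exact (h (hγ x)).trans_le (hz₀ (Set.mem_univ (γ 0)))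

/-- The winding numbers around small triangles vanish. -/
theorem exists_winding_eq_zero_of_length {f : C(gasket, ℂ)} (hf : ∀ z, f z ≠ 0) :
    ∃ N, ∀ w : HSG, N ≤ w.length → deltaWinding w f = 0 ∧ nablaWinding w f = 0 := by
  obtain ⟨δ, hδ, h⟩ := exists_windingNumber_eq_zero hf
  -- A cell of level `n` has diameter at most `2⁻ⁿ` times that of the gasket; the `+ 1` keeps the
  -- denominator positive.
  obtain ⟨N, hN⟩ := exists_pow_lt_of_lt_one (show 0 < δ / (Metric.diam gasket + 1) from
    div_pos hδ (by linarith [Metric.diam_nonneg (s := gasket)])) (one_half_lt_one (α := ℝ))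
  have hd : 0 < Metric.diam gasket + 1 := by linarith [Metric.diam_nonneg (s := gasket)]
  have key : ∀ w : HSG, N ≤ w.length → ∀ z ∈ gasket, ∀ z' ∈ gasket,
      dist (cellMap w z) (cellMap w z') < δ := by
    intro w hw z hz z' hz'
    have h1 : dist z z' ≤ Metric.diam gasket :=
      Metric.dist_le_diam_of_mem isCompact_gasket.isBounded hz hz'
    have h2 : (1 / 2 : ℝ) ^ w.length ≤ (1 / 2) ^ N :=
      pow_le_pow_of_le_one (by norm_num) (by norm_num) hw
    rw [dist_eq_norm, cellMap_sub, norm_div, norm_pow, Complex.norm_ofNat, ← dist_eq_norm]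
    calc dist z z' / 2 ^ w.length = (1 / 2) ^ w.length * dist z z' := by
          rw [one_div, inv_pow]; ring
      _ ≤ (1 / 2) ^ N * Metric.diam gasket := by gcongr
      _ ≤ (1 / 2) ^ N * (Metric.diam gasket + 1) := by gcongr; linarith
      _ < δ / (Metric.diam gasket + 1) * (Metric.diam gasket + 1) := by gcongr
      _ = δ := div_mul_cancel₀ _ hd.ne'
  exact ⟨N, fun w hw => ⟨h _ fun x => key w hw _ (triangleCurve_corner_mem _ x) _
    (triangleCurve_corner_mem _ 0), h _
      fun x => key w hw _ (triangleCurve_midpt_mem _ x) _ (triangleCurve_midpt_mem _ 0)⟩⟩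

theorem finsum_list_eq {g : HSG → ℤ} (hg : (Function.support g).Finite) :
    ∑ᶠ h, g h = g [] + ∑ i, ∑ᶠ h, g (i :: h) := by
  let c : Fin 3 × HSG → HSG := fun p => p.1 :: p.2
  have hc : Function.Injective c := by
    rintro ⟨i, h⟩ ⟨j, h'⟩ e
    simpa [c] using e
  have hu : (Set.univ : Set HSG) = {[]} ∪ Set.range c := by
    ext h
    rcases h with - | ⟨i, h⟩
    · simp
    · exact ⟨fun _ => Or.inr ⟨(i, h), rfl⟩, fun _ => trivial⟩
  have hdisj : Disjoint ({[]} : Set HSG) (Set.range c) := by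
    rw [Set.disjoint_singleton_left]
    rintro ⟨p, hp⟩
    exact List.cons_ne_nil _ _ hp
  rw [← finsum_mem_univ, hu, finsum_mem_union' hdisj (hg.inter_of_right _) (hg.inter_of_right _),
    finsum_mem_singleton, finsum_mem_range hc, finsum_curry, finsum_eq_sum_of_fintype]
  exact hg.preimage hc.injOn

/-- Induction on `N - w.length`, starting at the lengths where everything vanishes. Each step sorts
the extensions of `w` by their next letter. -/
theorem eq_finsum_of_eq_add_sum {d v : HSG → ℤ} (hd : ∀ w, d w = v w + ∑ i, d (w ++ [i]))
    {N : ℕ} (hN : ∀ w : HSG, N ≤ w.length → d w = 0 ∧ v w = 0) :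
    (Function.support v).Finite ∧ ∀ w, d w = ∑ᶠ h, v (w ++ h) := by
  have hfin : (Function.support v).Finite :=
    (List.finite_length_lt (Fin 3) N).subset fun w hw => by
      by_contra h
      exact hw (hN w (not_lt.1 h)).2
  have hfin' : ∀ w, (Function.support fun h => v (w ++ h)).Finite := fun w =>
    hfin.preimage (List.append_right_injective w).injOn
  refine ⟨hfin, fun w => ?_⟩
  induction hk : N - w.length generalizing w with
  | zero =>
    have h : N ≤ w.length := by omega
    have h0 : ∀ h, v (w ++ h) = 0 := fun h' => (hN _ (by rw [List.length_append]; omega)).2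
    simp [h0, (hN w h).1]
  | succ k ih =>
    rw [hd w, finsum_list_eq (hfin' w), List.append_nil]
    congr 1
    refine Finset.sum_congr rfl fun i _ => ?_
    rw [ih (w ++ [i]) (by rw [List.length_append, List.length_singleton]; omega)]
    simp

theorem deltaWinding_eq_finsum {f : C(gasket, ℂ)} (hf : ∀ z, f z ≠ 0) :
    {h | nablaWinding h f ≠ 0}.Finite ∧
      ∀ w, deltaWinding w f = ∑ᶠ h, nablaWinding (w ++ h) f := by
  obtain ⟨N, hN⟩ := exists_winding_eq_zero_of_length hf
  exact eq_finsum_of_eq_add_sum (deltaWinding_eq_add_sum hf) hN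

end SmallCells

/-! ### Containment of triangles as the prefix relation on words. -/

section Containment

theorem cellMap_combo (w : HSG) (a b : ℝ) (hab : a + b = 1) (z z' : ℂ) :
    cellMap w (a • z + b • z') = a • cellMap w z + b • cellMap w z' := by
  have h1 := cellMap_sub w (a • z + b • z') z
  have h2 := cellMap_sub w z' z
  obtain rfl : a = 1 - b := by linarith
  simp only [Complex.real_smul] at *
  push_cast at *
  linear_combination h1 - b * h2

theorem cellMap_injective (w : HSG) : Function.Injective (cellMap w) := by
  intro z z' h
  have := cellMap_sub w z z'
  rw [h, sub_self, eq_comm, div_eq_zero_iff, sub_eq_zero] at this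
  exact this.resolve_right (pow_ne_zero _ two_ne_zero)

theorem convex_cell (w : HSG) : Convex ℝ (cellMap w '' stage 0) := by
  rintro _ ⟨x, hx, rfl⟩ _ ⟨y, hy, rfl⟩ a b ha hb hab
  exact ⟨a • x + b • y, convex_convexHull ℝ (Set.range corner) hx hy ha hb hab,
    cellMap_combo w a b hab x y⟩

theorem gasket_subset_stage_zero : gasket ⊆ stage 0 :=
  Set.iInter_subset _ 0

theorem mem_range_triangleCurve (T : ℝ) [hT : Fact (0 < T)] (a b c : ℂ) :
    a ∈ Set.range (triangleCurve T a b c) ∧ b ∈ Set.range (triangleCurve T a b c) ∧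
      c ∈ Set.range (triangleCurve T a b c) := by
  have h0 : (0 : ℝ) ∈ Set.Icc (0 : ℝ) 1 := Set.left_mem_Icc.2 zero_le_one
  refine ⟨⟨((T * (0 / 3) : ℝ) : AddCircle T), ?_⟩, ⟨((T * ((1 + 0) / 3) : ℝ) : AddCircle T), ?_⟩,
    ⟨((T * ((2 + 0) / 3) : ℝ) : AddCircle T), ?_⟩⟩
  · rw [triangleCurve_coe T a b c (by norm_num), trianglePath_first a b c h0]
    simp
  · rw [triangleCurve_coe T a b c (by norm_num), trianglePath_second a b c h0]
    simp
  · rw [triangleCurve_coe T a b c (by norm_num), trianglePath_third a b c h0]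
    simp

theorem convexHull_range_deltaLoop (w : HSG) :
    convexHull ℝ (Set.range fun x => (deltaLoop w x : ℂ)) = cellMap w '' stage 0 := by
  apply subset_antisymm
  · refine convexHull_min ?_ (convex_cell w)
    rintro _ ⟨x, rfl⟩
    exact ⟨_, gasket_subset_stage_zero (triangleCurve_corner_mem _ x), rfl⟩
  · rw [Set.image_subset_iff]
    refine convexHull_min ?_ ?_
    · rintro _ ⟨i, rfl⟩
      apply subset_convexHull ℝ
      obtain ⟨⟨x, hx⟩, ⟨y, hy⟩, ⟨z, hz⟩⟩ := mem_range_triangleCurve (circumference w.length)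
        (corner 0) (corner 1) (corner 2)
      fin_cases i
      exacts [⟨x, congrArg (cellMap w) hx⟩, ⟨y, congrArg (cellMap w) hy⟩,
        ⟨z, congrArg (cellMap w) hz⟩]
    · intro x hx y hy a b ha hb hab
      change cellMap w (a • x + b • y) ∈ convexHull ℝ _
      rw [cellMap_combo w a b hab]
      exact convex_convexHull ℝ _ hx hy ha hb hab

/-- The midpoints of the sides have the same barycenter as the corners. Consequently a convex set
containing the triangle contains its center, and containment can be tested at one point. -/
theorem holeCenter_mem_convexHull (h : HSG) :
    holeCenter h ∈ convexHull ℝ (Set.range fun x => (nablaLoop h x : ℂ)) := by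
  obtain ⟨⟨x, hx⟩, ⟨y, hy⟩, ⟨z, hz⟩⟩ := mem_range_triangleCurve (circumference (h.length + 1))
    (midpt 0 1) (midpt 1 2) (midpt 2 0)
  have e : holeCenter h = (2 / 3 : ℝ) • ((1 / 2 : ℝ) • (nablaLoop h x : ℂ) +
      (1 / 2 : ℝ) • (nablaLoop h y : ℂ)) + (1 / 3 : ℝ) • (nablaLoop h z : ℂ) := by
    change cellMap h _ = (2 / 3 : ℝ) • ((1 / 2 : ℝ) • cellMap h _ + (1 / 2 : ℝ) • cellMap h _) +
      (1 / 3 : ℝ) • cellMap h _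
    rw [hx, hy, hz, ← cellMap_combo _ _ _ (by norm_num), ← cellMap_combo _ _ _ (by norm_num)]
    congr 1
    simp [midpt]
    ring
  have hc := convex_convexHull ℝ (Set.range fun x => (nablaLoop h x : ℂ))
  have hmem := fun x => subset_convexHull ℝ (Set.range fun x => (nablaLoop h x : ℂ)) ⟨x, rfl⟩
  rw [e]
  exact hc (hc (hmem x) (hmem y) (by norm_num) (by norm_num) (by norm_num)) (hmem z)
    (by norm_num) (by norm_num) (by norm_num)

theorem bary_holeCenter_pos (i : Fin 3) (w : HSG) : 0 < bary i (holeCenter w) := by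
  induction w with
  | nil =>
    change 0 < bary i ((corner 0 + corner 1 + corner 2) / 3)
    rw [bary_center]; norm_num
  | cons j w ih =>
    change 0 < bary i (shrink j (holeCenter w))
    rw [bary_shrink]; split_ifs <;> linarith

/-- The map `shrink j` with `j ≠ i` halves the `i`-th coordinate, which is below `1` at every
center; at the central hole it is `1/3`. -/
theorem bary_holeCenter_lt_half {i : Fin 3} {h : HSG} (hi : ∀ r, h ≠ i :: r) :
    bary i (holeCenter h) < 1 / 2 := by
  rcases h with - | ⟨j, r⟩
  · change bary i ((corner 0 + corner 1 + corner 2) / 3) < 1 / 2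
    rw [bary_center]; norm_num
  · have hij : i ≠ j := by rintro rfl; exact hi r rfl
    change bary i (shrink j (holeCenter r)) < 1 / 2
    rw [bary_shrink, if_neg hij]
    linarith [bary_holeCenter_lt i r]

/-- The first letter can be read off: in subcell `i` the `i`-th barycentric coordinate is at least
`1/2`, which excludes centers of holes whose word does not start with `i`. A common first letter is
removed by injectivity. -/
theorem prefix_of_holeCenter_mem {h w : HSG} (hm : holeCenter h ∈ cellMap w '' stage 0) :
    w <+: h := by
  induction w generalizing h with
  | nil => exact List.nil_prefix
  | cons i w ih =>
    obtain ⟨y, hy, e⟩ := hm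
    change shrink i (cellMap w y) = _ at e
    by_cases hi : ∃ r, h = i :: r
    · obtain ⟨r, rfl⟩ := hi
      rw [List.prefix_cons_inj]
      refine ih ⟨y, hy, ?_⟩
      exact cellMap_injective [i] e
    · push Not at hi
      have h1 := bary_holeCenter_lt_half hi
      have h2 : ∀ w : HSG, 0 ≤ bary i (cellMap w y) := by
        intro w
        induction w with
        | nil => exact bary_nonneg i 0 hy
        | cons j w ih =>
          change 0 ≤ bary i (shrink j (cellMap w y))
          rw [bary_shrink]; split_ifs <;> linarith
      rw [← e, bary_shrink, if_pos rfl] at h1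
      linarith [h2 w]

theorem nablaInDelta_iff (h w : HSG) : NablaInDelta h w ↔ w <+: h := by
  rw [NablaInDelta, convexHull_range_deltaLoop]
  constructor
  · intro hs
    exact prefix_of_holeCenter_mem (convexHull_min hs (convex_cell w) (holeCenter_mem_convexHull h))
  · rintro ⟨r, rfl⟩
    rintro _ ⟨x, rfl⟩
    refine ⟨cellMap r (triangleCurve _ (midpt 0 1) (midpt 1 2) (midpt 2 0) x),
      gasket_subset_stage_zero (cellMap_mem_gasket r (triangleCurve_midpt_mem _ x)), ?_⟩
    exact (cellMap_append w r _).symm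

theorem setOf_nablaInDelta (w : HSG) : {h | NablaInDelta h w} = Set.range (w ++ ·) := by
  ext h
  exact nablaInDelta_iff h w

end Containment

end

end Gasket

namespace Gasket

noncomputable section

/-! ### Winding numbers of the standard generators. -/

section Generators

/-- The quotient is a positive real function. This disposes of the normalization of the generator
and of the scale of the cell at once. -/
theorem windingNumber_eq_of_pos_mul {T : ℝ} {g h : C(AddCircle T, ℂ)} (hh : ∀ x, h x ≠ 0)
    (hgh : ∀ x, ∃ r : ℝ, 0 < r ∧ g x = r * h x) : windingNumber g = windingNumber h := by
  have e : g = ⟨fun x => g x / h x, g.continuous.div h.continuous hh⟩ * h := by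
    ext x; simp [hh x]
  have hpos : ∀ x, 0 < (1 * (g x / h x)).re := fun x => by
    obtain ⟨r, hr, hx⟩ := hgh x
    rw [one_mul, hx, mul_div_cancel_right₀ _ (hh x)]
    exact hr
  rw [e, windingNumber_mul (fun x hx => ?_) hh, windingNumber_eq_zero_of_re_pos 1 hpos, zero_add]
  have := hpos x
  rw [show g x / h x = 0 from hx] at this
  simp at this

/-- A barycentric coordinate is a real affine function; this form turns a separating line into the
half plane condition of `windingNumber_eq_zero_of_re_pos`. -/
theorem exists_bary_sub (i : Fin 3) :
    ∃ β : ℂ, ∀ z z' : ℂ, bary i z - bary i z' = (β * (z - z')).re := by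
  let b : Fin 3 → ℂ := ![⟨-(1 / (2 * Real.pi / 3)), 1 / (Real.pi * √3 / 3) -
    1 / √3 / (2 * Real.pi / 3)⟩, ⟨1 / (2 * Real.pi / 3), 1 / √3 / (2 * Real.pi / 3)⟩,
    ⟨0, -(1 / (Real.pi * √3 / 3))⟩]
  refine ⟨b i, fun z z' => ?_⟩
  fin_cases i <;> simp [bary, b] <;> ring

theorem bary_midpt_le {i j : Fin 3} (hij : i ≠ j) (l : Fin 3) : bary l (midpt i j) ≤ 1 / 2 := by
  have e : midpt i j = (1 / 2 : ℝ) • corner i + (1 / 2 : ℝ) • corner j := by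
    simp [midpt]; ring
  rw [e, bary_combo _ _ _ _ _ (by norm_num), bary_corner, bary_corner]
  split_ifs with h1 h2
  · exact absurd (h1.symm.trans h2) hij
  all_goals norm_num

theorem bary_triangleCurve_midpt_le (T : ℝ) [hT : Fact (0 < T)] (x : AddCircle T) (l : Fin 3) :
    bary l (triangleCurve T (midpt 0 1) (midpt 1 2) (midpt 2 0) x) ≤ 1 / 2 := by
  have key : ∀ p q : ℂ, bary l p ≤ 1 / 2 → bary l q ≤ 1 / 2 → ∀ z ∈ segment ℝ p q,
      bary l z ≤ 1 / 2 := by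
    rintro p q hp hq _ ⟨a, b, ha, hb, hab, rfl⟩
    rw [bary_combo _ _ _ _ _ hab]
    nlinarith
  have h0 := bary_midpt_le (show (0 : Fin 3) ≠ 1 by decide) l
  have h1 := bary_midpt_le (show (1 : Fin 3) ≠ 2 by decide) l
  have h2 := bary_midpt_le (show (2 : Fin 3) ≠ 0 by decide) l
  rcases triangleCurve_mem T (midpt 0 1) (midpt 1 2) (midpt 2 0) x with (h | h) | h
  exacts [key _ _ h0 h1 _ h, key _ _ h1 h2 _ h, key _ _ h2 h0 _ h]

/-- The center of a hole and the boundary of another hole are separated by a line. -/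
theorem exists_separation {v h : HSG} (hne : v ≠ h) : ∃ α : ℂ, ∀ z ∈ gasket,
    (∀ i, bary i z ≤ 1 / 2) → 0 < (α * (cellMap v z - holeCenter h)).re := by
  induction v generalizing h with
  | nil =>
    rcases h with - | ⟨i, r⟩
    · exact absurd rfl hne
    · obtain ⟨β, hβ⟩ := exists_bary_sub i
      -- The center lies inside subcell `i`, with `i`-th coordinate above `1/2`, while on the
      -- central hole the coordinate is at most `1/2`.
      refine ⟨-β, fun z _ hz => ?_⟩
      have h1 := bary_shrink i i (holeCenter r)
      rw [if_pos rfl] at h1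
      have h2 := bary_holeCenter_pos i r
      rw [neg_mul, Complex.neg_re, ← hβ]
      change 0 < -(bary i z - bary i (shrink i (holeCenter r)))
      linarith [hz i]
  | cons i v ih =>
    by_cases hi : ∃ r, h = i :: r
    · obtain ⟨r, rfl⟩ := hi
      obtain ⟨α, hα⟩ := ih (h := r) fun e => hne (by rw [e])
      refine ⟨α, fun z hz hb => ?_⟩
      have e : cellMap (i :: v) z - holeCenter (i :: r) =
          ((1 / 2 : ℝ) : ℂ) * (cellMap v z - holeCenter r) := by
        change shrink i (cellMap v z) - shrink i (holeCenter r) = _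
        rw [shrink, shrink]
        push_cast
        ring
      rw [e, mul_left_comm, Complex.re_ofReal_mul]
      exact mul_pos (by norm_num) (hα z hz hb)
    · push Not at hi
      obtain ⟨β, hβ⟩ := exists_bary_sub i
      -- Here the sides are exchanged: the curve lies in subcell `i`, and the center has `i`-th
      -- coordinate below `1/2`.
      refine ⟨β, fun z hz _ => ?_⟩
      have h1 := bary_holeCenter_lt_half hi
      have h2 := bary_nonneg i 0 (gasket_subset_stage_zero (cellMap_mem_gasket v hz))
      have h3 := bary_shrink i i (cellMap v z)
      rw [if_pos rfl] at h3
      rw [← hβ]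
      change 0 < bary i (shrink i (cellMap v z)) - _
      linarith

theorem nablaWinding_holeUnitary_of_ne {v h : HSG} (hne : v ≠ h) :
    nablaWinding v (holeUnitary h : C(gasket, ℂ)) = 0 := by
  obtain ⟨α, hα⟩ := exists_separation hne
  refine windingNumber_eq_zero_of_re_pos α fun x => ?_
  have h1 := hα _ (triangleCurve_midpt_mem (circumference (v.length + 1)) x)
    (bary_triangleCurve_midpt_le _ x)
  have h2 : 0 < ‖(nablaLoop v x : ℂ) - holeCenter h‖ := norm_pos_iff.2 (holeCenter_ne h _)
  change 0 < (α * (((nablaLoop v x : ℂ) - holeCenter h) /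
    (‖(nablaLoop v x : ℂ) - holeCenter h‖ : ℂ))).re
  rw [← mul_div_assoc, Complex.div_ofReal_re]
  exact div_pos h1 h2

/-- Along the segment `(z - c) / (p - c) = 1 + t (ω - 1)`, which starts at `1` and then has positive
imaginary part, so the principal logarithm is continuous on it. -/
theorem hasSegmentIncrement_rotation {p q c : ℂ} (hp : p - c ≠ 0)
    (hq : q - c = Complex.exp ((2 * Real.pi / 3 : ℝ) * Complex.I) * (p - c)) :
    HasSegmentIncrement (fun z => z - c) p q ((2 * Real.pi / 3 : ℝ) * Complex.I) := by
  set ω := Complex.exp ((2 * Real.pi / 3 : ℝ) * Complex.I) with hω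
  have him : 0 < ω.im := by
    rw [hω, Complex.exp_ofReal_mul_I_im]
    exact Real.sin_pos_of_pos_of_lt_pi (by positivity) (by linarith [Real.pi_pos])
  have hs : ∀ t ∈ Set.Icc (0 : ℝ) 1, 1 + (t : ℂ) * (ω - 1) ∈ Complex.slitPlane := by
    intro t ht
    rcases eq_or_lt_of_le ht.1 with rfl | h
    · simp
    · refine Or.inr ?_
      simpa using ⟨h.ne', him.ne'⟩
  refine ⟨fun t => Complex.log (1 + (t : ℂ) * (ω - 1)) + Complex.log (p - c),
    ((by fun_prop : Continuous fun t : ℝ => 1 + (t : ℂ) * (ω - 1)).continuousOn.clog hs).add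
      continuousOn_const, fun t ht => ?_, ?_⟩
  · rw [Complex.exp_add, Complex.exp_log hp, Complex.exp_log (Complex.slitPlane_ne_zero (hs t ht))]
    linear_combination -(t : ℂ) * hq
  · have hlog : Complex.log ω = (2 * Real.pi / 3 : ℝ) * Complex.I := by
      have e : ((2 * Real.pi / 3 : ℝ) * Complex.I : ℂ).im = 2 * Real.pi / 3 := by
        rw [Complex.im_ofReal_mul, Complex.I_im, mul_one]
      apply Complex.log_exp <;> rw [e] <;> linarith [Real.pi_pos]
    simp [hlog]

/-- Rotation by `2π/3` about the center permutes the three midpoints cyclically, so each side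
contributes a third of `2πi`. -/
theorem windingNumber_triangleCurve_midpt (T : ℝ) [hT : Fact (0 < T)] :
    windingNumber (triangleCurve T (midpt 0 1) (midpt 1 2) (midpt 2 0) -
      ContinuousMap.const _ ((corner 0 + corner 1 + corner 2) / 3)) = 1 := by
  have hne : ∀ x, (triangleCurve T (midpt 0 1) (midpt 1 2) (midpt 2 0) -
      ContinuousMap.const _ ((corner 0 + corner 1 + corner 2) / 3) :
        C(AddCircle T, ℂ)) x ≠ 0 := fun x =>
    holeCenter_ne [] ⟨_, triangleCurve_midpt_mem T x⟩
  set c := (corner 0 + corner 1 + corner 2) / 3 with hc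
  have hω : Complex.exp ((2 * Real.pi / 3 : ℝ) * Complex.I) = ⟨-1 / 2, √3 / 2⟩ := by
    have e : 2 * Real.pi / 3 = Real.pi - Real.pi / 3 := by ring
    apply Complex.ext
    · rw [Complex.exp_ofReal_mul_I_re, e, Real.cos_pi_sub, Real.cos_pi_div_three]
      norm_num
    · rw [Complex.exp_ofReal_mul_I_im, e, Real.sin_pi_sub, Real.sin_pi_div_three]
  have h3 : Real.pi * (√3 * √3) = Real.pi * 3 := by rw [Real.mul_self_sqrt (by norm_num)]
  have r1 : midpt 1 2 - c = Complex.exp ((2 * Real.pi / 3 : ℝ) * Complex.I) * (midpt 0 1 - c) := by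
    rw [hω]
    apply Complex.ext <;> simp [midpt, hc, corner] <;>
      linarith
  have r2 : midpt 2 0 - c = Complex.exp ((2 * Real.pi / 3 : ℝ) * Complex.I) * (midpt 1 2 - c) := by
    rw [hω]
    apply Complex.ext <;> simp [midpt, hc, corner] <;>
      linarith
  have r3 : midpt 0 1 - c = Complex.exp ((2 * Real.pi / 3 : ℝ) * Complex.I) * (midpt 2 0 - c) := by
    rw [hω]
    apply Complex.ext <;> simp [midpt, hc, corner] <;>
      linarith
  have hx := mem_range_triangleCurve T (midpt 0 1) (midpt 1 2) (midpt 2 0)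
  obtain ⟨⟨x₁, hx₁⟩, ⟨x₂, hx₂⟩, ⟨x₃, hx₃⟩⟩ := hx
  have n1 : midpt 0 1 - c ≠ 0 := hx₁ ▸ hne x₁
  have n2 : midpt 1 2 - c ≠ 0 := hx₂ ▸ hne x₂
  have n3 : midpt 2 0 - c ≠ 0 := hx₃ ▸ hne x₃
  obtain ⟨x, y, z, h1, h2, h3, hsum⟩ := exists_segmentIncrements
    (hasWindingNumber_windingNumber hne) (F := fun z => z - c) (a := midpt 0 1) (b := midpt 1 2)
    (c := midpt 2 0) fun x => rfl
  rw [h1.unique (hasSegmentIncrement_rotation n1 r1),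
    h2.unique (hasSegmentIncrement_rotation n2 r2),
    h3.unique (hasSegmentIncrement_rotation n3 r3)] at hsum
  have h2pi : (2 * Real.pi * Complex.I : ℂ) ≠ 0 := Complex.two_pi_I_ne_zero
  have := mul_left_cancel₀ h2pi (hsum.symm.trans (b := _) (c := 2 * Real.pi * Complex.I * 1)
    (by push_cast; ring))
  exact_mod_cast this

theorem nablaWinding_holeUnitary_self (h : HSG) :
    nablaWinding h (holeUnitary h : C(gasket, ℂ)) = 1 := by
  rw [← windingNumber_triangleCurve_midpt (circumference (h.length + 1))]
  refine windingNumber_eq_of_pos_mul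
    (fun x => holeCenter_ne [] ⟨_, triangleCurve_midpt_mem _ x⟩) fun x => ?_
  have hn : 0 < ‖(nablaLoop h x : ℂ) - holeCenter h‖ := norm_pos_iff.2 (holeCenter_ne h _)
  -- The factor combines the scale of the cell with the normalization of the generator, reducing to
  -- the central hole.
  refine ⟨1 / 2 ^ h.length / ‖(nablaLoop h x : ℂ) - holeCenter h‖, by positivity, ?_⟩
  change ((nablaLoop h x : ℂ) - holeCenter h) / (‖(nablaLoop h x : ℂ) - holeCenter h‖ : ℂ) =
    _ * (triangleCurve _ (midpt 0 1) (midpt 1 2) (midpt 2 0) x -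
      (corner 0 + corner 1 + corner 2) / 3)
  have e : (nablaLoop h x : ℂ) - holeCenter h = _ := cellMap_sub h _ _
  push_cast
  generalize (‖(nablaLoop h x : ℂ) - holeCenter h‖ : ℂ) = N
  rw [e]
  ring

theorem nablaWinding_holeUnitary (v h : HSG) :
    nablaWinding v (holeUnitary h : C(gasket, ℂ)) = if v = h then 1 else 0 := by
  split_ifs with hv
  · rw [hv, nablaWinding_holeUnitary_self]
  · exact nablaWinding_holeUnitary_of_ne hv

end Generators

/-! ### Assembly: cell winding numbers as sums over the holes inside. -/

section Main

theorem unitary_apply_ne_zero (u : unitary C(gasket, ℂ)) (z : gasket) :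
    (u : C(gasket, ℂ)) z ≠ 0 := by
  intro h
  have h1 := DFunLike.congr_fun (Unitary.mul_star_self_of_mem u.2) z
  rw [ContinuousMap.mul_apply, h] at h1
  simp at h1

theorem deltaWinding_eq_finsum_mem {f : C(gasket, ℂ)} (hf : ∀ z, f z ≠ 0) (w : HSG) :
    deltaWinding w f = ∑ᶠ h ∈ {h | NablaInDelta h w}, nablaWinding h f := by
  rw [(deltaWinding_eq_finsum hf).2 w, setOf_nablaInDelta,
    finsum_mem_range (List.append_right_injective w)]

theorem deltaWinding_holeUnitary (w h : HSG) :
    deltaWinding w (holeUnitary h : C(gasket, ℂ)) =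
      Set.indicator {h | NablaInDelta h w} (fun _ => (1 : ℤ)) h := by
  rw [deltaWinding_eq_finsum_mem (unitary_apply_ne_zero _), finsum_mem_def,
    finsum_eq_single _ h]
  · simp only [Set.indicator, nablaWinding_holeUnitary, if_true]
  · intro v hv
    simp [Set.indicator, nablaWinding_holeUnitary, hv]

end Main

end

end Gasket
theorem proposition3p1 :
    -- the index maps of the modules of all triangles exist as homomorphisms on `K₁(C(SG))`
    ∃ ΦΔ ΦN : Gasket.HSG → (Gasket.K1 C(Gasket.gasket, ℂ) →+ ℤ),
      (∀ w, Gasket.IsIndexMap (Gasket.deltaUFM w) (ΦΔ w)) ∧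
      (∀ h, Gasket.IsIndexMap (Gasket.nablaUFM h) (ΦN h)) ∧
      -- the index map of an upward triangle is the winding number around it
      (∀ (w : Gasket.HSG) (u : unitary C(Gasket.gasket, ℂ)),
        ΦΔ w (Gasket.K1.ofUnitary u) = Gasket.deltaWinding w u) ∧
      -- the index map of a downward triangle is the winding number around it
      (∀ (h : Gasket.HSG) (u : unitary C(Gasket.gasket, ℂ)),
        ΦN h (Gasket.K1.ofUnitary u) = Gasket.nablaWinding h u) ∧
      -- sum over the downward triangles inside; only finitely many terms do not vanish
      (∀ (w : Gasket.HSG) (u : unitary C(Gasket.gasket, ℂ)),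
        {h | Gasket.NablaInDelta h w ∧ Gasket.nablaWinding h u ≠ 0}.Finite ∧
        ΦΔ w (Gasket.K1.ofUnitary u) =
          ∑ᶠ (h : Gasket.HSG) (_ : Gasket.NablaInDelta h w), Gasket.nablaWinding h u) ∧
      -- the element of `∏ ℤ`: by its values on the generators of `K₁(C(SG))`, and by its pairing
      -- with the coordinates (winding numbers around the holes) of an arbitrary class
      (∀ w : Gasket.HSG,
        Gasket.holeCoordinates (ΦΔ w) =
          Set.indicator {h | Gasket.NablaInDelta h w} (fun _ => (1 : ℤ)) ∧
        ∀ (n : ℕ) (u : Matrix.unitaryGroup (Fin n) C(Gasket.gasket, ℂ)),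
          {h | Gasket.nablaWinding h u.1.det ≠ 0}.Finite ∧
          ΦΔ w (Gasket.K1.mk u) = ∑ᶠ h : Gasket.HSG,
            Set.indicator {h | Gasket.NablaInDelta h w} (fun _ => (1 : ℤ)) h *
              Gasket.nablaWinding h u.1.det) := by
  refine ⟨fun w => Gasket.windingHom (Gasket.deltaLoop w),
    fun h => Gasket.windingHom (Gasket.nablaLoop h),
    fun w => Gasket.isIndexMap_windingHom _, fun h => Gasket.isIndexMap_windingHom _,
    fun w u => Gasket.windingHom_ofUnitary _ u, fun h u => Gasket.windingHom_ofUnitary _ u,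
    fun w u => ⟨?_, ?_⟩, fun w => ⟨?_, fun n u => ⟨?_, ?_⟩⟩⟩
  · exact (Gasket.deltaWinding_eq_finsum (Gasket.unitary_apply_ne_zero u)).1.subset
      fun h hh => hh.2
  · exact (Gasket.windingHom_ofUnitary _ u).trans
      (Gasket.deltaWinding_eq_finsum_mem (Gasket.unitary_apply_ne_zero u) w)
  · funext h
    exact (Gasket.windingHom_ofUnitary _ _).trans (Gasket.deltaWinding_holeUnitary w h)
  · exact (Gasket.deltaWinding_eq_finsum (Gasket.det_unitary_apply_ne_zero u)).1
  -- The decomposition over holes needs only a function without zeros, so it applies to `det u`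
  -- directly.
  · refine (Gasket.deltaWinding_eq_finsum_mem (Gasket.det_unitary_apply_ne_zero u) w).trans ?_
    rw [finsum_mem_def]
    refine finsum_congr fun h => ?_
    by_cases hh : h ∈ {h | Gasket.NablaInDelta h w}
    · rw [Set.indicator_of_mem hh, Set.indicator_of_mem hh, one_mul]
    · rw [Set.indicator_of_notMem hh, Set.indicator_of_notMem hh, zero_mul]
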